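/- **Setting.** For a real number $s\ge 0$ let $\langle s\rangle=\{-\lfloor s/2\rfloor,\dots,\lfloor s/2\rfloor\}\subset\mathbb Z$, so $|\langle s\rangle|=2\lfloor s/2\rfloor+1$. Let $k,n,m\in\mathbb N$, where $k\ge 4$ is a power of $2$, $n\ge 1$ and $m>30^{\log_2 k+1}$, and let $p=m^{-1/(\log_2 k+1)}$. The *$k$-Tree algorithm* takes lists $L_1,\dots,L_k$ of $n$ integers from $\langle m\rangle$. It puts $L^0_i=L_i$ and, for $d=1,\dots,\log_2 k$, lets $L^d_i$ (for $1\le i\le k/2^d$) be the list, with duplicates, of all sums $a+b$ with $a\in L^{d-1}_{2i-1}$, $b\in L^{d-1}_{2i}$, $|a+b|\le p^d m/2$. If $L_1^{\log_2 k}$ contains $0$, it outputs indices $\ell_1,\dots,\ell_k$ in the input lists that led to this sum; otherwise it fails. It *succeeds* if it outputs $\ell_1,\dots,\ell_k$ with $\sum_i L_i[\ell_i]=0$. Let $C$ be the number of occurrences of $0$ in $L_1^{\log_2 k}$. Probabilities and expectations are over input lists with independent entries uniform in $\langle m\rangle$. **The procedure.** For $s>0$ write $D=|\langle s\rangle|$,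 $t=\lfloor sp/2\rfloor$, $E=|\langle sp\rangle|=2t+1$ and $$P_0(s,z)=\frac1D-\frac{|z|}{D^2},\qquad A(s)=\frac{2t+1}{D}-\frac{t^2+t}{D^2},\qquad B(s)=\max\Big(\frac{E\,P_0(s,0)}{A(s)},\ \frac{A(s)}{E\,P_0(s,t)}\Big),$$ $$N=2(\lfloor s/2\rfloor-t)+1,\quad x=E-1,\quad y=E-1-t,\qquad A_2(s)=\frac{N E^2}{D^3}+\frac{2}{D^3}\cdot\frac{x(x+1)(2x+1)-y(y+1)(2y+1)}{6},$$ $$B_2(s)=\max\Big(\frac{E^2}{D^2A_2(s)},\ \frac{D^3A_2(s)}{E^2N}\Big).$$ The procedure $\mathrm{ProbBounds}(m,k,n,p)$ computes * $UB_1=\dfrac{n^k}{|\langle mp^{\log_2 k}\rangle|}\displaystyle\prod_{d=0}^{\log_2 k-1}\big(A(mp^d)\,B(mp^d)\big)^{k/2^{d+1}}$ and $LB_1=\dfrac{n^k}{|\langle mp^{\log_2 k}\rangle|}\displaystyle\prod_{d=0}^{\log_2 k-1}\Big(\frac{A(mp^d)}{B(mp^d)}\Big)^{k/2^{d+1}}$,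 by a loop over $d$; * $UB_2=f(m,k,n)$ by the recursion $f(m,1,n)=nu(nu+1)$ with $u=1/|\langle m\rangle|$, and $f(m,k,n)=f(mp,k/2,n')$ with $n'=\big((A(m)B(m))^2n^4+2A_2(m)B_2(m)n^3\big)^{1/2}$ for $k\ge 2$; and outputs $UB=\min(UB_1,1)$ and $LB=LB_1^2/UB_2$. **Theorem.** For all such $m,k,n,p$, $$LB\ \le\ \Pr[\text{the $k$-Tree algorithm succeeds}]\ \le\ UB .$$ Moreover the quantities from which $UB$ and $LB$ are formed are bounds on moments: $LB_1\le\mathbb E[C]\le UB_1$ and $\mathbb E[C^2]\le UB_2$. Finally, the procedure runs in time $\mathrm{polylog}(m,k,n)$: there are absolute constants $K$ and $e$ such that, for all such inputs, a fixed program for it outputs $UB$ and $LB$ after at most $K(\log m+\log k+\log n)^e$ steps. Here a step is one elementary operation on real numbers: $+,-,\times,/,\max,\min,\sqrt{\ }$, a comparison, a register access, a constant, or an assignment; rounding down a number additionally costs the length of its integer part in binary. Powers and $\log_2 k$ are computed from these operations. -/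

import Mathlib

noncomputable section

namespace KTree

/-! ## The k-Tree algorithm over the integers, with `k = 2 ^ l` lists of `n` numbers -/

/-- The integer interval `⟨m⟩ = {-⌊m/2⌋, …, ⌊m/2⌋}` from which list entries are drawn. -/
def range (m : ℕ) : Finset ℤ := Finset.Icc (-((m / 2 : ℕ) : ℤ)) ((m / 2 : ℕ) : ℤ)

/-- An input: `k` lists, each consisting of `n` integers from `⟨m⟩`. -/
abbrev Input (k n m : ℕ) : Type := Fin k → Fin n → {z : ℤ // z ∈ range m}

/-- An entry of an intermediate list: a sum, together with the indices (in the input lists that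
contribute to it, from left to right) of its summands. -/
abbrev Entry (n : ℕ) : Type := ℤ × List (Fin n)

/-- `Merge(A, B, τ)`: all sums `a + b` with `a ∈ A`, `b ∈ B` and `|a + b| ≤ τ`,
with duplicates. -/
def merge {n : ℕ} (τ : ℝ) (A B : List (Entry n)) : List (Entry n) :=
  A.flatMap fun a =>
    (B.filter fun b => decide (|((a.1 + b.1 : ℤ) : ℝ)| ≤ τ)).map fun b => (a.1 + b.1, a.2 ++ b.2)

/-- The main loop with `l` rounds left, current threshold `τ` and current lists `L`. In one round
`τ` is replaced by `p * τ`, and then neighbouring lists are merged with this new threshold. -/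
def loop {n : ℕ} (p : ℝ) : (l : ℕ) → ℝ → (Fin (2 ^ l) → List (Entry n)) → List (Entry n)
  | 0, _, L => L ⟨0, by simp⟩
  | l + 1, τ, L =>
      loop p l (p * τ) fun i =>
        merge (p * τ) (L ⟨2 * i.1, by have := i.2; rw [pow_succ]; omega⟩)
          (L ⟨2 * i.1 + 1, by have := i.2; rw [pow_succ]; omega⟩)

/-- The last list `L₁^{log k}` that the algorithm computes on the input `L`. -/
def finalList (l n m : ℕ) (p : ℝ) (L : Input (2 ^ l) n m) : List (Entry n) :=
  loop p l ((m : ℝ) / 2) fun i => List.ofFn fun j => ((L i j : ℤ), [j])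

/-- The output of the algorithm: the indices that led to a sum `0` in the last list,
or `none` (failure) if that list does not contain `0`. -/
def kTree (l n m : ℕ) (p : ℝ) (L : Input (2 ^ l) n m) : Option (List (Fin n)) :=
  ((finalList l n m p L).find? fun a => decide (a.1 = 0)).map Prod.snd

/-- The algorithm succeeds: it outputs `(ℓ₁, …, ℓ_k)` with `∑ i, L_i[ℓ_i] = 0`. -/
def Succeeds (l n m : ℕ) (p : ℝ) (L : Input (2 ^ l) n m) : Prop :=
  ∃ ix : Fin (2 ^ l) → Fin n,
    kTree l n m p L = some (List.ofFn ix) ∧ ∑ i, (L i (ix i) : ℤ) = 0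

/-- The random variable `C`: the number of occurrences of `0` in the last list. -/
def zeroCount (l n m : ℕ) (p : ℝ) (L : Input (2 ^ l) n m) : ℕ :=
  (finalList l n m p L).countP fun a => decide (a.1 = 0)

/-- Expectation over independent uniform list entries, that is, over a uniform input. -/
def expectation {k n m : ℕ} (X : Input k n m → ℝ) : ℝ :=
  (∑ L, X L) / (Fintype.card (Input k n m) : ℝ)

open Classical in
/-- The success probability of the algorithm on uniformly random input lists. -/
def successProb (l n m : ℕ) (p : ℝ) : ℝ :=
  (Fintype.card {L : Input (2 ^ l) n m // Succeeds l n m p L} : ℝ)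
    / (Fintype.card (Input (2 ^ l) n m) : ℝ)

/-! ## The values computed by the procedure `ProbBounds` -/

/-- `|⟨s⟩| = 2 ⌊s/2⌋ + 1`. -/
def rangeSize (s : ℝ) : ℝ := 2 * (⌊s / 2⌋ : ℝ) + 1

def probSumToZ (s z : ℝ) : ℝ :=
  1 / rangeSize s - |z| / rangeSize s ^ 2

def probSumInRange (s p : ℝ) : ℝ :=
  let t : ℝ := ⌊s * p / 2⌋
  (2 * t + 1) / rangeSize s - (t ^ 2 + t) / rangeSize s ^ 2

def mrDistFromUnif (s p : ℝ) : ℝ :=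
  let α := probSumToZ s 0 / probSumInRange s p
  let β := probSumToZ s (⌊s * p / 2⌋ : ℝ) / probSumInRange s p
  let u := 1 / rangeSize (s * p)
  max (α / u) (u / β)

/-- The summand `α` is the contribution of the `2 (⌊s/2⌋ - ⌊sp/2⌋) + 1` values `w` with
`|w| ≤ ⌊s/2⌋ - ⌊sp/2⌋`, the summand `β` that of all other `w`. -/
def probSumWithTwoRVInRange (s p : ℝ) : ℝ :=
  let α := (2 * ((⌊s / 2⌋ : ℝ) - ⌊s * p / 2⌋) + 1) * (rangeSize (s * p) ^ 2 / rangeSize s ^ 3)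
  let x := rangeSize (s * p) - 1
  let y := rangeSize (s * p) - 1 - ⌊s * p / 2⌋
  let β := 2 / rangeSize s ^ 3
    * ((x * (x + 1) * (2 * x + 1) - y * (y + 1) * (2 * y + 1)) / 6)
  α + β

def mrDistFromPairUnif (s p : ℝ) : ℝ :=
  let α := 1 / (rangeSize s ^ 2 * probSumWithTwoRVInRange s p)
  let β := (2 * ((⌊s / 2⌋ : ℝ) - ⌊s * p / 2⌋) + 1)
    / (rangeSize s ^ 3 * probSumWithTwoRVInRange s p)
  let u := 1 / rangeSize (s * p) ^ 2
  max (α / u) (u / β)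

/-- The factors `(UB, LB)` of level `d`, for `k = 2 ^ l` lists. -/
def firstMomentInductFactors (m : ℝ) (l : ℕ) (p : ℝ) (d : ℕ) : ℝ × ℝ :=
  let s := m * p ^ d
  let α := probSumInRange s p ^ (2 ^ l / 2 ^ (d + 1))
  let β := mrDistFromUnif s p ^ (2 ^ l / 2 ^ (d + 1))
  (α * β, α / β)

/-- The bounds `(UB, LB)` on the first moment, for `k = 2 ^ l` lists. -/
def firstMomentBounds (m : ℝ) (l : ℕ) (n p : ℝ) : ℝ × ℝ :=
  let base := n ^ (2 ^ l) * (1 / rangeSize (m * p ^ l))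
  ((∏ d ∈ Finset.range l, (firstMomentInductFactors m l p d).1) * base,
    (∏ d ∈ Finset.range l, (firstMomentInductFactors m l p d).2) * base)

def probUnifXMRDist (m p : ℝ) : ℝ := probSumInRange m p * mrDistFromUnif m p

def probUnifXMRDistPair (m p : ℝ) : ℝ := probSumWithTwoRVInRange m p * mrDistFromPairUnif m p

/-- The upper bound on the second moment, by recursion on `l = log k`. -/
def secondMomentUB (p : ℝ) : ℕ → ℝ → ℝ → ℝ
  | 0, m, n =>
      let u := 1 / rangeSize m
      (n * u) * (n * u + 1)
  | l + 1, m, n =>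
      secondMomentUB p l (m * p)
        √(probUnifXMRDist m p ^ 2 * n ^ 4 + 2 * probUnifXMRDistPair m p * n ^ 3)

/-- The pair `(UB, LB)` computed by `ProbBounds(m, k, n, p)`, for `k = 2 ^ l`. -/
def probBounds (m : ℝ) (l : ℕ) (n p : ℝ) : ℝ × ℝ :=
  (min (firstMomentBounds m l n p).1 1,
    (firstMomentBounds m l n p).2 ^ 2 / secondMomentUB p l m n)

/-! ## A machine model: while programs over finitely many real registers

Every arithmetic operation, comparison, access to a register or a constant, and assignment costs
one step. There are no powers and logarithms: a program has to compute them. Rounding down a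
number costs in addition the length of its integer part in binary. Division by zero and square
roots of negative numbers are not defined: a program that attempts one has no execution. -/

/-- The registers. -/
inductive Reg : Type
  | m | k | n | p | ub | lb | logk | d | s | e | x | y | a | b | u₁ | l₁ | m' | k' | n' | u₂
  deriving DecidableEq

abbrev State : Type := Reg → ℝ

inductive Expr : Type
  | rd (r : Reg)
  | const (c : ℕ)
  | add (f g : Expr)
  | sub (f g : Expr)
  | mul (f g : Expr)
  | div (f g : Expr)
  | max (f g : Expr)
  | min (f g : Expr)
  | sqrt (f : Expr)
  | floor (f : Expr)

namespace Expr

def eval (σ : State) : Expr → ℝ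
  | rd r => σ r
  | const c => (c : ℝ)
  | add f g => f.eval σ + g.eval σ
  | sub f g => f.eval σ - g.eval σ
  | mul f g => f.eval σ * g.eval σ
  | div f g => f.eval σ / g.eval σ
  | max f g => Max.max (f.eval σ) (g.eval σ)
  | min f g => Min.min (f.eval σ) (g.eval σ)
  | sqrt f => √(f.eval σ)
  | floor f => (⌊f.eval σ⌋ : ℝ)

/-- No division by zero and no square root of a negative number occurs. -/
def Defined (σ : State) : Expr → Prop
  | rd _ => True
  | const _ => True
  | add f g => f.Defined σ ∧ g.Defined σ
  | sub f g => f.Defined σ ∧ g.Defined σ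
  | mul f g => f.Defined σ ∧ g.Defined σ
  | div f g => f.Defined σ ∧ g.Defined σ ∧ g.eval σ ≠ 0
  | max f g => f.Defined σ ∧ g.Defined σ
  | min f g => f.Defined σ ∧ g.Defined σ
  | sqrt f => f.Defined σ ∧ 0 ≤ f.eval σ
  | floor f => f.Defined σ

def cost (σ : State) : Expr → ℕ
  | rd _ => 1
  | const _ => 1
  | add f g => f.cost σ + g.cost σ + 1
  | sub f g => f.cost σ + g.cost σ + 1
  | mul f g => f.cost σ + g.cost σ + 1
  | div f g => f.cost σ + g.cost σ + 1
  | max f g => f.cost σ + g.cost σ + 1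
  | min f g => f.cost σ + g.cost σ + 1
  | sqrt f => f.cost σ + 1
  | floor f => f.cost σ + 1 + Nat.size ⌊|f.eval σ|⌋₊

instance : Add Expr := ⟨add⟩
instance : Sub Expr := ⟨sub⟩
instance : Mul Expr := ⟨mul⟩
instance : Div Expr := ⟨div⟩
instance (c : ℕ) : OfNat Expr c := ⟨const c⟩

end Expr

inductive Cmd : Type
  | assign (r : Reg) (f : Expr)
  | seq (c₁ c₂ : Cmd)
  | whileLT (f g : Expr) (body : Cmd)

infix:60 " ≔ " => Cmd.assign
infixr:50 " ;; " => Cmd.seq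

/-- `Exec c σ τ t`: started in the state `σ`, the command `c` terminates in the state `τ`
after exactly `t` steps. The loop `whileLT f g body` runs `body` as long as `f < g`. -/
inductive Exec : Cmd → State → State → ℕ → Prop
  | assign (r : Reg) (f : Expr) (σ : State) (hf : f.Defined σ) :
      Exec (r ≔ f) σ (Function.update σ r (f.eval σ)) (f.cost σ + 1)
  | seq (c₁ c₂ : Cmd) (σ τ ρ : State) (s t : ℕ) (h₁ : Exec c₁ σ τ s) (h₂ : Exec c₂ τ ρ t) :
      Exec (c₁ ;; c₂) σ ρ (s + t)
  | whileStop (f g : Expr) (body : Cmd) (σ : State) (hf : f.Defined σ) (hg : g.Defined σ)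
      (h : ¬ f.eval σ < g.eval σ) :
      Exec (Cmd.whileLT f g body) σ σ (f.cost σ + g.cost σ + 1)
  | whileStep (f g : Expr) (body : Cmd) (σ τ ρ : State) (s t : ℕ)
      (hf : f.Defined σ) (hg : g.Defined σ) (h : f.eval σ < g.eval σ)
      (h₁ : Exec body σ τ s) (h₂ : Exec (Cmd.whileLT f g body) τ ρ t) :
      Exec (Cmd.whileLT f g body) σ ρ (f.cost σ + g.cost σ + 1 + s + t)

/-! ## The program `ProbBounds` -/

namespace Expr

def rangeSize (s : Expr) : Expr := 2 * floor (s / 2) + 1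

def sq (f : Expr) : Expr := f * f

def cube (f : Expr) : Expr := f * f * f

def abs (f : Expr) : Expr := max f (0 - f)

def probSumToZ (s z : Expr) : Expr :=
  1 / rangeSize s - abs z / sq (rangeSize s)

def probSumInRange (s p : Expr) : Expr :=
  let t := floor (s * p / 2)
  (2 * t + 1) / rangeSize s - (sq t + t) / sq (rangeSize s)

def mrDistFromUnif (s p : Expr) : Expr :=
  let α := probSumToZ s 0 / probSumInRange s p
  let β := probSumToZ s (floor (s * p / 2)) / probSumInRange s p
  let u := 1 / rangeSize (s * p)
  max (α / u) (u / β)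

def probSumWithTwoRVInRange (s p : Expr) : Expr :=
  let α := (2 * (floor (s / 2) - floor (s * p / 2)) + 1)
    * (sq (rangeSize (s * p)) / cube (rangeSize s))
  let x := rangeSize (s * p) - 1
  let y := rangeSize (s * p) - 1 - floor (s * p / 2)
  let β := 2 / cube (rangeSize s)
    * ((x * (x + 1) * (2 * x + 1) - y * (y + 1) * (2 * y + 1)) / 6)
  α + β

def mrDistFromPairUnif (s p : Expr) : Expr :=
  let α := 1 / (sq (rangeSize s) * probSumWithTwoRVInRange s p)
  let β := (2 * (floor (s / 2) - floor (s * p / 2)) + 1)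
    / (cube (rangeSize s) * probSumWithTwoRVInRange s p)
  let u := 1 / sq (rangeSize (s * p))
  max (α / u) (u / β)

def probUnifXMRDist (m p : Expr) : Expr := probSumInRange m p * mrDistFromUnif m p

def probUnifXMRDistPair (m p : Expr) : Expr :=
  probSumWithTwoRVInRange m p * mrDistFromPairUnif m p

end Expr

open Reg
open KTree.Expr (rd)

/-- `r ← f ^ g` by repeated multiplication, for a natural number `g`
(`f` must not use the registers `r` and `e`, and `g` must not use `r`). -/
def powNat (r : Reg) (f g : Expr) : Cmd :=
  r ≔ 1 ;;
  e ≔ g ;;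
  Cmd.whileLT 0 (rd e) (
    r ≔ rd r * f ;;
    e ≔ rd e - 1)

/-- `r ← f ^ g` by repeated squaring, where `g` is a power of two (and does not use `r`). -/
def powTwo (r : Reg) (f g : Expr) : Cmd :=
  r ≔ f ;;
  e ≔ g ;;
  Cmd.whileLT 1 (rd e) (
    r ≔ rd r * rd r ;;
    e ≔ rd e / 2)

/-- `a ← UB` and `b ← LB` for the level in register `d`. -/
def firstMomentInductFactorsCmd : Cmd :=
  powNat x (rd p) (rd d) ;;
  s ≔ rd m * rd x ;;
  powNat y 2 (rd d + 1) ;;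
  powTwo a (Expr.probSumInRange (rd s) (rd p)) (rd k / rd y) ;;
  powTwo b (Expr.mrDistFromUnif (rd s) (rd p)) (rd k / rd y) ;;
  x ≔ rd a * rd b ;;
  b ≔ rd a / rd b ;;
  a ≔ rd x

/-- `u₁ ← UB` and `l₁ ← LB`; the first loop computes `log k`. -/
def firstMomentBoundsCmd : Cmd :=
  logk ≔ 0 ;;
  e ≔ rd k ;;
  Cmd.whileLT 1 (rd e) (
    e ≔ rd e / 2 ;;
    logk ≔ rd logk + 1) ;;
  powNat x (rd p) (rd logk) ;;
  powTwo u₁ (rd n) (rd k) ;;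
  u₁ ≔ rd u₁ * (1 / Expr.rangeSize (rd m * rd x)) ;;
  l₁ ≔ rd u₁ ;;
  d ≔ 0 ;;
  Cmd.whileLT (rd d) (rd logk) (
    firstMomentInductFactorsCmd ;;
    u₁ ≔ rd a * rd u₁ ;;
    l₁ ≔ rd b * rd l₁ ;;
    d ≔ rd d + 1)

/-- `u₂ ← UB`; the tail recursion is a loop on `m'`, `k'`, `n'`. -/
def secondMomentUBCmd : Cmd :=
  m' ≔ rd m ;;
  k' ≔ rd k ;;
  n' ≔ rd n ;;
  Cmd.whileLT 1 (rd k') (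
    n' ≔ Expr.sqrt (Expr.sq (Expr.probUnifXMRDist (rd m') (rd p)) * Expr.sq (Expr.sq (rd n'))
      + 2 * Expr.probUnifXMRDistPair (rd m') (rd p) * Expr.cube (rd n')) ;;
    m' ≔ rd m' * rd p ;;
    k' ≔ rd k' / 2) ;;
  u₂ ≔ rd n' * (1 / Expr.rangeSize (rd m')) * (rd n' * (1 / Expr.rangeSize (rd m')) + 1)

def probBoundsCmd : Cmd :=
  firstMomentBoundsCmd ;;
  secondMomentUBCmd ;;
  ub ≔ Expr.min (rd u₁) 1 ;;
  lb ≔ Expr.sq (rd l₁) / rd u₂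

/-- The initial state on the input `m, k, n, p`. -/
def inputState (m₀ k₀ n₀ p₀ : ℝ) : State
  | .m => m₀
  | .k => k₀
  | .n => n₀
  | .p => p₀
  | _ => 0

end KTree

end

/-!
The number `C` of zeros in the last list is a sum over index tuples, and one round of the algorithm
turns pairs of independent, identically distributed lists into such lists again. So it suffices to
follow, from round to round, estimates for the expected counts of single values and of pairs of
values in one random list `X` at scale `s`, whose entries lie in `⟨s⟩`; the counts of a merged list
are a truncated convolution of the counts of the two lists (`count_merge`).

*First moment* (`expect_count_loop`). If every value of `⟨s⟩` has expected count between
`lo / |⟨s⟩|` and `hi / |⟨s⟩|`, the expected count of `z ∈ ⟨sp⟩` in the merged list lies between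
`lo² P₀(s, z)` and `hi² P₀(s, z)`, where `P₀(s, z)` is the probability that two uniform elements of
`⟨s⟩` have the sum `z`. The ratio `B(s)` compares `P₀(s, ·)` on `⟨sp⟩` with its average
`A(s) / |⟨sp⟩|`, so the hypothesis is reproduced at scale `sp` with `lo² A / B` and `hi² A B`. This
is exactly the recursion of the products that define the bounds.

*Second moment* (`expect_count_sq_loop`). For `ν` uniform entries, the expected product of the
counts of `z` and `z'` is at most `ν² / |⟨s⟩|² + [z = z'] ν / |⟨s⟩|`. Such an estimate reproduces
itself: in a merged list a pair of sums `(a + b, a' + b')` is formed from pairs `(a, a')` and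
`(b, b')` each of which is of independent or of equal type, and the four cases contribute at most
`(AB)² ν⁴`, twice `A₂ B₂ ν³`, and, on the diagonal, `A B ν²`. With `ν'` the square root of
`(AB)² ν⁴ + 2 A₂ B₂ ν³`, all of this is at most `ν'² / |⟨sp⟩|² + [z = z'] ν' / |⟨sp⟩|`. The pair
case needs only that `1 / |⟨s⟩|²` is at most `A₂ B₂ / |⟨sp⟩|²`, which is built into `B₂`.

The algorithm succeeds exactly if `C > 0` (`succeeds_iff`), so the upper bound is `Pr[C > 0] ≤ E[C]`
and the lower bound is `E[C]² ≤ Pr[C > 0] E[C²]`.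

*Running time.* All rounded numbers are at most `m`, so every rounding costs `O(log m)` steps. The
outer loops run `log k` times, the inner loops for the powers at most `log k` times, and
`m > 30 ^ (log k + 1)` bounds `log k` by `log m`. The program therefore takes `O((log m)²)` steps.
-/

namespace KTree

/-! ### Sums of two uniform entries at one level -/

lemma half_floor_bounds {s p : ℝ} (hs : 0 ≤ s) (hp : 0 ≤ p) (hp1 : p ≤ 1) :
    (0 : ℝ) ≤ (⌊s * p / 2⌋ : ℝ) ∧ (⌊s * p / 2⌋ : ℝ) ≤ (⌊s / 2⌋ : ℝ) := by
  constructor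
  · exact_mod_cast Int.floor_nonneg.2 (by positivity)
  · exact_mod_cast Int.floor_le_floor (by nlinarith)

lemma rangeSize_pos {s : ℝ} (hs : 0 ≤ s) : 0 < rangeSize s := by
  have : (0 : ℝ) ≤ (⌊s / 2⌋ : ℝ) := by exact_mod_cast Int.floor_nonneg.2 (by positivity)
  unfold rangeSize
  linarith

lemma probSumToZ_eq {s : ℝ} (hs : 0 ≤ s) (z : ℝ) :
    probSumToZ s z = (rangeSize s - |z|) / rangeSize s ^ 2 := by
  have := (rangeSize_pos hs).ne'
  unfold probSumToZ
  field_simp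

lemma probSumToZ_pos {s z : ℝ} (hs : 0 ≤ s) (hz : |z| ≤ (⌊s / 2⌋ : ℝ)) :
    0 < probSumToZ s z := by
  rw [probSumToZ_eq hs]
  have h := rangeSize_pos hs
  have h0 := abs_nonneg z
  refine div_pos ?_ (by positivity)
  unfold rangeSize
  linarith

lemma probSumToZ_le_of_abs_le {s z w : ℝ} (h : |z| ≤ |w|) : probSumToZ s w ≤ probSumToZ s z := by
  unfold probSumToZ
  gcongr

lemma probSumInRange_pos {s p : ℝ} (hs : 0 ≤ s) (hp : 0 ≤ p) (hp1 : p ≤ 1) :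
    0 < probSumInRange s p := by
  obtain ⟨h0, h1⟩ := half_floor_bounds hs hp hp1
  have h := rangeSize_pos hs
  have e : probSumInRange s p = ((2 * (⌊s * p / 2⌋ : ℝ) + 1) * rangeSize s
      - ((⌊s * p / 2⌋ : ℝ) ^ 2 + (⌊s * p / 2⌋ : ℝ))) / rangeSize s ^ 2 := by
    unfold probSumInRange
    field_simp
  rw [e]
  refine div_pos ?_ (by positivity)
  unfold rangeSize
  nlinarith

lemma probSumToZ_half_pos {s p : ℝ} (hs : 0 ≤ s) (hp : 0 ≤ p) (hp1 : p ≤ 1) :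
    0 < probSumToZ s (⌊s * p / 2⌋ : ℝ) := by
  obtain ⟨h0, h1⟩ := half_floor_bounds hs hp hp1
  exact probSumToZ_pos hs (by rwa [abs_of_nonneg h0])

lemma mrDistFromUnif_pos {s p : ℝ} (hs : 0 ≤ s) (hp : 0 ≤ p) (hp1 : p ≤ 1) :
    0 < mrDistFromUnif s p := by
  have h1 := probSumInRange_pos hs hp hp1
  have h2 := probSumToZ_half_pos hs hp hp1
  have h3 : 0 < rangeSize (s * p) := rangeSize_pos (by positivity)
  exact lt_max_of_lt_right (by positivity)

/-- Half of what `B(s)` is made for: `P₀(s, ·)` exceeds its average over `⟨sp⟩` at most by the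
factor `B(s)`. -/
lemma probSumToZ_le {s p : ℝ} (hs : 0 ≤ s) (hp : 0 ≤ p) (hp1 : p ≤ 1) (z : ℝ) :
    probSumToZ s z ≤ probUnifXMRDist s p / rangeSize (s * p) := by
  have h1 := probSumInRange_pos hs hp hp1
  have h3 : 0 < rangeSize (s * p) := rangeSize_pos (by positivity)
  calc probSumToZ s z ≤ probSumToZ s 0 := probSumToZ_le_of_abs_le (by simp)
    _ = probSumInRange s p
          * (probSumToZ s 0 / probSumInRange s p / (1 / rangeSize (s * p)))
          / rangeSize (s * p) := by field_simp
    _ ≤ _ := by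
        unfold probUnifXMRDist
        gcongr
        exact le_max_left _ _

/-- The other half: on `⟨sp⟩`, `P₀(s, ·)` falls below its average at most by the factor `B(s)`. -/
lemma le_probSumToZ {s p z : ℝ} (hs : 0 ≤ s) (hp : 0 ≤ p) (hp1 : p ≤ 1)
    (hz : |z| ≤ (⌊s * p / 2⌋ : ℝ)) :
    probSumInRange s p / mrDistFromUnif s p / rangeSize (s * p) ≤ probSumToZ s z := by
  have h1 := probSumInRange_pos hs hp hp1
  have h2 := probSumToZ_half_pos hs hp hp1
  have h3 : 0 < rangeSize (s * p) := rangeSize_pos (by positivity)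
  have h4 := mrDistFromUnif_pos hs hp hp1
  have h5 : 1 / rangeSize (s * p) / (probSumToZ s (⌊s * p / 2⌋ : ℝ) / probSumInRange s p)
      ≤ mrDistFromUnif s p := le_max_right _ _
  calc probSumInRange s p / mrDistFromUnif s p / rangeSize (s * p)
      ≤ probSumToZ s (⌊s * p / 2⌋ : ℝ) := by
        rw [div_div, div_le_iff₀ (by positivity)]
        rw [div_le_iff₀ (by positivity), div_le_iff₀ h3] at h5
        field_simp at h5
        linarith
    _ ≤ probSumToZ s z :=
        probSumToZ_le_of_abs_le (hz.trans (le_abs_self _))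

lemma probSumWithTwoRVInRange_pos {s p : ℝ} (hs : 0 ≤ s) (hp : 0 ≤ p) (hp1 : p ≤ 1) :
    0 < probSumWithTwoRVInRange s p := by
  obtain ⟨h0, h1⟩ := half_floor_bounds hs hp hp1
  have h := rangeSize_pos hs
  have h3 : 0 < rangeSize (s * p) := rangeSize_pos (by positivity)
  have hα : 0 < (2 * ((⌊s / 2⌋ : ℝ) - ⌊s * p / 2⌋) + 1)
      * (rangeSize (s * p) ^ 2 / rangeSize s ^ 3) :=
    mul_pos (by linarith) (by positivity)
  refine add_pos_of_pos_of_nonneg hα (mul_nonneg (by positivity) (div_nonneg ?_ (by norm_num)))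
  rw [sub_nonneg]
  unfold rangeSize
  generalize (⌊s * p / 2⌋ : ℝ) = t at *
  rw [show 2 * t + 1 - 1 - t = t by ring, show 2 * t + 1 - 1 = 2 * t by ring]
  have : t ≤ 2 * t := by linarith
  gcongr

/-- The counterpart for pairs: for uniform `a`, `b`, `b'` in `⟨s⟩`, the pair `(a + b, a + b')` takes
each value with probability at most `1 / |⟨s⟩|²`. -/
lemma one_div_rangeSize_sq_le {s p : ℝ} (hs : 0 ≤ s) (hp : 0 ≤ p) (hp1 : p ≤ 1) :
    1 / rangeSize s ^ 2 ≤ probUnifXMRDistPair s p / rangeSize (s * p) ^ 2 := by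
  have h := rangeSize_pos hs
  have h1 := probSumWithTwoRVInRange_pos hs hp hp1
  have h3 : 0 < rangeSize (s * p) := rangeSize_pos (by positivity)
  calc 1 / rangeSize s ^ 2 = probSumWithTwoRVInRange s p
          * (1 / (rangeSize s ^ 2 * probSumWithTwoRVInRange s p) / (1 / rangeSize (s * p) ^ 2))
          / rangeSize (s * p) ^ 2 := by field_simp
    _ ≤ _ := by
        unfold probUnifXMRDistPair
        gcongr
        exact le_max_left _ _

lemma probUnifXMRDist_pos {s p : ℝ} (hs : 0 ≤ s) (hp : 0 ≤ p) (hp1 : p ≤ 1) :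
    0 < probUnifXMRDist s p :=
  mul_pos (probSumInRange_pos hs hp hp1) (mrDistFromUnif_pos hs hp hp1)

lemma probUnifXMRDistPair_pos {s p : ℝ} (hs : 0 ≤ s) (hp : 0 ≤ p) (hp1 : p ≤ 1) :
    0 < probUnifXMRDistPair s p := by
  have h := rangeSize_pos hs
  have h1 := probSumWithTwoRVInRange_pos hs hp hp1
  have h3 : 0 < rangeSize (s * p) := rangeSize_pos (by positivity)
  exact mul_pos h1 (lt_max_of_lt_left (by positivity))

/-! ### Recursion of the bounds along the levels -/

lemma firstMomentInductFactors_zero (s : ℝ) (l : ℕ) (p : ℝ) :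
    firstMomentInductFactors s (l + 1) p 0
      = (probUnifXMRDist s p ^ 2 ^ l, (probSumInRange s p / mrDistFromUnif s p) ^ 2 ^ l) := by
  simp [firstMomentInductFactors, probUnifXMRDist, mul_pow, div_pow, pow_succ]

lemma firstMomentInductFactors_succ (s : ℝ) (l : ℕ) (p : ℝ) (d : ℕ) :
    firstMomentInductFactors s (l + 1) p (d + 1) = firstMomentInductFactors (s * p) l p d := by
  have h1 : s * p ^ (d + 1) = s * p * p ^ d := by ring
  have h2 : 2 ^ (l + 1) / 2 ^ (d + 1 + 1) = 2 ^ l / 2 ^ (d + 1) := by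
    rw [pow_succ, pow_succ 2 (d + 1), Nat.mul_div_mul_right _ _ two_pos]
  simp [firstMomentInductFactors, h1, h2]

lemma firstMomentBounds_succ_fst (s : ℝ) (l : ℕ) (ν p : ℝ) :
    (firstMomentBounds s (l + 1) ν p).1
      = (firstMomentBounds (s * p) l (ν ^ 2 * probUnifXMRDist s p) p).1 := by
  simp only [firstMomentBounds, Finset.prod_range_succ', firstMomentInductFactors_succ,
    firstMomentInductFactors_zero]
  rw [show s * p ^ (l + 1) = s * p * p ^ l by ring, mul_pow, ← pow_mul, ← pow_succ']
  ring

lemma firstMomentBounds_succ_snd (s : ℝ) (l : ℕ) (ν p : ℝ) :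
    (firstMomentBounds s (l + 1) ν p).2
      = (firstMomentBounds (s * p) l
          (ν ^ 2 * (probSumInRange s p / mrDistFromUnif s p)) p).2 := by
  simp only [firstMomentBounds, Finset.prod_range_succ', firstMomentInductFactors_succ,
    firstMomentInductFactors_zero]
  rw [show s * p ^ (l + 1) = s * p * p ^ l by ring, mul_pow _ (probSumInRange s p / _), ← pow_mul,
    ← pow_succ']
  ring

lemma firstMomentBounds_snd_nonneg {p : ℝ} (hp : 0 ≤ p) (hp1 : p ≤ 1) (l : ℕ) {s ν : ℝ}
    (hs : 0 ≤ s) (hν : 0 ≤ ν) : 0 ≤ (firstMomentBounds s l ν p).2 := by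
  induction l generalizing s ν with
  | zero =>
    have := rangeSize_pos hs
    simp only [firstMomentBounds, Finset.range_zero, Finset.prod_empty, pow_zero, mul_one]
    positivity
  | succ l ih =>
    rw [firstMomentBounds_succ_snd]
    have h1 := probSumInRange_pos hs hp hp1
    have h2 := mrDistFromUnif_pos hs hp hp1
    exact ih (by positivity) (by positivity)

lemma secondMomentUB_pos {p : ℝ} (hp : 0 ≤ p) (hp1 : p ≤ 1) (l : ℕ) {s ν : ℝ}
    (hs : 0 ≤ s) (hν : 0 < ν) : 0 < secondMomentUB p l s ν := by
  induction l generalizing s ν with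
  | zero =>
    have := rangeSize_pos hs
    simp only [secondMomentUB]
    positivity
  | succ l ih =>
    have h1 := probUnifXMRDist_pos hs hp hp1
    have h2 := probUnifXMRDistPair_pos hs hp hp1
    exact ih (by positivity) (by positivity)

/-! ### Intermediate lists -/

/-- The number of entries of an intermediate list whose sum is `z`. -/
def count {n : ℕ} (A : List (Entry n)) (z : ℤ) : ℕ := A.countP fun a => decide (a.1 = z)

lemma count_eq_zero {n : ℕ} {A : List (Entry n)} {M : ℤ} (hA : ∀ a ∈ A, |a.1| ≤ M) {z : ℤ}
    (hz : M < |z|) : count A z = 0 := by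
  refine List.countP_eq_zero.2 fun a ha => ?_
  have := hA a ha
  simp only [decide_eq_true_eq]
  rintro rfl
  omega

lemma mem_merge {n : ℕ} {τ : ℝ} {A B : List (Entry n)} {c : Entry n} :
    c ∈ merge τ A B ↔ ∃ a ∈ A, ∃ b ∈ B, |((a.1 + b.1 : ℤ) : ℝ)| ≤ τ ∧
      (a.1 + b.1, a.2 ++ b.2) = c := by
  simp only [merge, List.mem_flatMap, List.mem_map, List.mem_filter, decide_eq_true_eq, and_assoc]

/-- Up to the threshold, the counts of a merged list are a convolution. -/
lemma count_merge {n : ℕ} {τ : ℝ} {A B : List (Entry n)} {M z : ℤ} (hA : ∀ a ∈ A, |a.1| ≤ M)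
    (hz : |(z : ℝ)| ≤ τ) :
    count (merge τ A B) z = ∑ a ∈ Finset.Icc (-M) M, count A a * count B (z - a) := by
  have key : count (merge τ A B) z = (A.map fun a => count B (z - a.1)).sum := by
    rw [count, merge, List.countP_flatMap]
    congr 2
    funext a
    simp only [Function.comp_apply, List.countP_map, List.countP_filter, count]
    refine List.countP_congr fun b _ => ?_
    simp only [Bool.and_eq_true, decide_eq_true_eq]
    constructor
    · rintro ⟨h, -⟩; omega
    · intro h
      have : a.1 + b.1 = z := by omega
      exact ⟨this, this ▸ hz⟩
  rw [key]
  clear key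
  induction A with
  | nil => simp [count]
  | cons a A ih =>
    have ha := abs_le.1 (hA a (by simp))
    simp only [List.map_cons, List.sum_cons, ih fun a h => hA a (by simp [h])]
    simp only [count, List.countP_cons, decide_eq_true_eq, add_mul, Finset.sum_add_distrib, ite_mul,
      one_mul, zero_mul, Finset.sum_ite_eq, Finset.mem_Icc, ha.1, ha.2, and_self, if_true]
    omega

lemma sum_fin_two_pow_succ {α : Type*} [AddCommMonoid α] {l : ℕ} (f : Fin (2 ^ (l + 1)) → α) :
    ∑ i, f i = ∑ i : Fin (2 ^ l), (f ⟨2 * i.1, by have := i.2; rw [pow_succ]; omega⟩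
      + f ⟨2 * i.1 + 1, by have := i.2; rw [pow_succ]; omega⟩) := by
  rw [← List.sum_ofFn, ← List.sum_ofFn,
    List.ofFn_congr (pow_succ' 2 l), List.ofFn_mul', List.sum_flatten, List.map_ofFn]
  congr 2
  funext i
  simp [List.ofFn_succ]

lemma flatten_ofFn_two_pow_succ {α : Type*} {l : ℕ} (f : Fin (2 ^ (l + 1)) → List α) :
    (List.ofFn f).flatten
      = (List.ofFn fun i : Fin (2 ^ l) => f ⟨2 * i.1, by have := i.2; rw [pow_succ]; omega⟩
        ++ f ⟨2 * i.1 + 1, by have := i.2; rw [pow_succ]; omega⟩).flatten := by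
  rw [List.ofFn_congr (pow_succ' 2 l), List.ofFn_mul', List.flatten_flatten, List.map_ofFn]
  congr 2
  funext i
  simp [List.ofFn_succ]

lemma half_lt {l : ℕ} (j : Fin (2 ^ (l + 1))) : j.1 / 2 < 2 ^ l := by
  have := j.2
  omega

/-- Every entry of the last list comes from one entry of each input list, in order. -/
lemma exists_of_mem_loop {n : ℕ} {p : ℝ} (l : ℕ) {τ : ℝ} {L : Fin (2 ^ l) → List (Entry n)}
    {c : Entry n} (hc : c ∈ loop p l τ L) :
    ∃ g : Fin (2 ^ l) → Entry n, (∀ i, g i ∈ L i) ∧ c.1 = ∑ i, (g i).1 ∧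
      c.2 = (List.ofFn fun i => (g i).2).flatten := by
  induction l generalizing τ with
  | zero => exact ⟨fun _ => c, fun i => by
      obtain rfl : i = ⟨0, by simp⟩ := Fin.ext (by have := i.2; simp at this; omega)
      exact hc, by simp, by simp⟩
  | succ l ih =>
    obtain ⟨g, hg, h1, h2⟩ := ih hc
    simp only [mem_merge] at hg
    choose a ha b hb _ hab using hg
    refine ⟨fun j => if j.1 % 2 = 0 then a ⟨j.1 / 2, half_lt j⟩
      else b ⟨j.1 / 2, half_lt j⟩, fun j => ?_, ?_, ?_⟩
    · dsimp only
      split_ifs with h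
      · convert ha ⟨j.1 / 2, half_lt j⟩ using 2
        ext; simp only; omega
      · convert hb ⟨j.1 / 2, half_lt j⟩ using 2
        ext; simp only; omega
    · rw [h1, sum_fin_two_pow_succ]
      refine Finset.sum_congr rfl fun i _ => ?_
      simp [← hab, Nat.mul_add_div]
    · rw [h2, flatten_ofFn_two_pow_succ]
      congr 2
      funext i
      simp [← hab, Nat.mul_add_div]

/-- The algorithm succeeds exactly if its last list contains `0`. -/
lemma succeeds_iff {l n m : ℕ} {p : ℝ} (L : Input (2 ^ l) n m) :
    Succeeds l n m p L ↔ 0 < zeroCount l n m p L := by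
  rw [zeroCount, List.countP_pos_iff]
  constructor
  · rintro ⟨ix, h, -⟩
    obtain ⟨a, ha, -⟩ := Option.map_eq_some_iff.1 h
    exact ⟨a, List.mem_of_find?_eq_some ha, by simpa using List.find?_some ha⟩
  · rintro ⟨a, ha, h0⟩
    obtain ⟨c, hc⟩ := Option.isSome_iff_exists.1
      (List.find?_isSome.2 ⟨a, ha, h0⟩ :
        ((finalList l n m p L).find? fun a => decide (a.1 = 0)).isSome)
    have hc0 : c.1 = 0 := by simpa using List.find?_some hc
    obtain ⟨g, hg, h1, h2⟩ := exists_of_mem_loop l (List.mem_of_find?_eq_some hc)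
    simp only [List.mem_ofFn] at hg
    choose ix hix using hg
    refine ⟨ix, ?_, ?_⟩
    · simp only [kTree, hc, Option.map_some, h2, ← hix]
      congr 1
      rw [show (fun i => [ix i]) = (fun a => [a]) ∘ ix from rfl, ← List.map_ofFn,
        ← List.flatMap_def, List.flatMap_singleton']
    · rw [← hc0, h1]
      simp [← hix]

open scoped BigOperators

/-! ### Expectations over independent lists -/

lemma expect_prod_mul {α β : Type*} [Fintype α] [Fintype β] (f : α → ℝ) (g : β → ℝ) :
    𝔼 w : α × β, f w.1 * g w.2 = (𝔼 a, f a) * 𝔼 b, g b := by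
  rw [← Finset.univ_product_univ, Finset.expect_product, Finset.expect_mul_expect]

/-- Neighbouring coordinates are grouped into pairs, as one round of the main loop does. -/
def pairEquiv (Ω : Type*) (l : ℕ) : (Fin (2 ^ (l + 1)) → Ω) ≃ (Fin (2 ^ l) → Ω × Ω) where
  toFun ω i := (ω ⟨2 * i.1, by have := i.2; rw [pow_succ]; omega⟩,
    ω ⟨2 * i.1 + 1, by have := i.2; rw [pow_succ]; omega⟩)
  invFun f j := if j.1 % 2 = 0 then (f ⟨j.1 / 2, half_lt j⟩).1 else (f ⟨j.1 / 2, half_lt j⟩).2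
  left_inv ω := by
    funext j
    dsimp only
    split_ifs <;> congr 1 <;> ext <;> simp only <;> omega
  right_inv f := by
    funext i
    simp [Nat.mul_add_div]

lemma expect_loop_zero {Ω : Type*} [Fintype Ω] {n : ℕ} (F : List (Entry n) → ℝ)
    (X : Ω → List (Entry n)) (p τ : ℝ) :
    𝔼 ω : Fin (2 ^ 0) → Ω, F (loop p 0 τ fun i => X (ω i)) = 𝔼 ω, F (X ω) :=
  Fintype.expect_equiv (Equiv.funUnique (Fin 1) Ω) _ _ fun _ => rfl

/-- One round: independent copies of a random list become half as many independent copies of the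
merge of two of them. -/
lemma expect_loop_succ {Ω : Type*} [Fintype Ω] {n l : ℕ} (F : List (Entry n) → ℝ)
    (X : Ω → List (Entry n)) (p τ : ℝ) :
    𝔼 ω : Fin (2 ^ (l + 1)) → Ω, F (loop p (l + 1) τ fun i => X (ω i))
      = 𝔼 ω : Fin (2 ^ l) → Ω × Ω,
          F (loop p l (p * τ) fun i => merge (p * τ) (X (ω i).1) (X (ω i).2)) :=
  Fintype.expect_equiv (pairEquiv Ω l) _ _ fun _ => rfl

/-- The values `a` with `a` and `z - a` in `{-M, …, M}`. -/
noncomputable def splittings (M z : ℤ) : Finset ℤ := (Finset.Icc (-M) M).filter fun a => |z - a| ≤ M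

lemma card_splittings {M z : ℤ} (hM : 0 ≤ M) (hz : |z| ≤ M) :
    ((splittings M z).card : ℤ) = 2 * M + 1 - |z| := by
  have : splittings M z = Finset.Icc (max (-M) (z - M)) (min M (z + M)) := by
    ext a
    simp only [splittings, Finset.mem_filter, Finset.mem_Icc, abs_le]
    omega
  rw [this, Int.card_Icc]
  rcases abs_cases z with h | h <;> omega

lemma card_splittings_eq {s : ℝ} (hs : 0 ≤ s) {z : ℤ} (hz : |z| ≤ ⌊s / 2⌋) :
    ((splittings ⌊s / 2⌋ z).card : ℝ) = rangeSize s ^ 2 * probSumToZ s z := by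
  have h := card_splittings (Int.floor_nonneg.2 (by positivity)) hz
  have := rangeSize_pos hs
  rw [probSumToZ_eq hs, mul_div_cancel₀ _ (by positivity), rangeSize]
  exact_mod_cast h

lemma sum_Icc_eq_sum_splittings {M z : ℤ} {f g : ℤ → ℝ} (hg : ∀ b, M < |b| → g b = 0) :
    ∑ a ∈ Finset.Icc (-M) M, f a * g (z - a) = ∑ a ∈ splittings M z, f a * g (z - a) := by
  refine (Finset.sum_subset (Finset.filter_subset _ _) fun a ha hn => ?_).symm
  rw [hg, mul_zero]
  by_contra h
  exact hn (Finset.mem_filter.2 ⟨ha, not_lt.1 h⟩)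

/-- By independence, the expected counts of a merged list are a truncated convolution. -/
lemma expect_count_merge {Ω : Type*} [Fintype Ω] {n : ℕ} {X : Ω → List (Entry n)} {M : ℤ}
    (hX : ∀ ω, ∀ a ∈ X ω, |a.1| ≤ M) {τ : ℝ} {z : ℤ} (hz : |(z : ℝ)| ≤ τ) :
    𝔼 w : Ω × Ω, (count (merge τ (X w.1) (X w.2)) z : ℝ)
      = ∑ a ∈ splittings M z,
          (𝔼 ω, (count (X ω) a : ℝ)) * 𝔼 ω, (count (X ω) (z - a) : ℝ) := by
  rw [← sum_Icc_eq_sum_splittings (f := fun a => 𝔼 ω, (count (X ω) a : ℝ))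
    (g := fun a => 𝔼 ω, (count (X ω) a : ℝ))]
  · simp only [fun w : Ω × Ω => count_merge (B := X w.2) (hX w.1) hz, Nat.cast_sum, Nat.cast_mul,
      Finset.expect_sum_comm]
    exact Finset.sum_congr rfl fun a _ =>
      expect_prod_mul (fun ω => (count (X ω) a : ℝ)) fun ω => (count (X ω) (z - a) : ℝ)
  · intro b hb
    simp [fun ω => count_eq_zero (hX ω) hb]

lemma expect_count_mul_merge {Ω : Type*} [Fintype Ω] {n : ℕ} {X : Ω → List (Entry n)} {M : ℤ}
    (hX : ∀ ω, ∀ a ∈ X ω, |a.1| ≤ M) {τ : ℝ} {z z' : ℤ} (hz : |(z : ℝ)| ≤ τ)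
    (hz' : |(z' : ℝ)| ≤ τ) :
    𝔼 w : Ω × Ω, (count (merge τ (X w.1) (X w.2)) z * count (merge τ (X w.1) (X w.2)) z' : ℝ)
      = ∑ a ∈ splittings M z, ∑ a' ∈ splittings M z',
          (𝔼 ω, (count (X ω) a * count (X ω) a' : ℝ))
            * 𝔼 ω, (count (X ω) (z - a) * count (X ω) (z' - a') : ℝ) := by
  have h0 : ∀ w : Ω × Ω, ∀ ζ : ℤ, |(ζ : ℝ)| ≤ τ → (count (merge τ (X w.1) (X w.2)) ζ : ℝ)
      = ∑ a ∈ splittings M ζ, (count (X w.1) a : ℝ) * count (X w.2) (ζ - a) := by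
    intro w ζ hζ
    rw [count_merge (hX w.1) hζ, ← sum_Icc_eq_sum_splittings
      (f := fun a => (count (X w.1) a : ℝ)) (g := fun a => (count (X w.2) a : ℝ))]
    · push_cast; rfl
    · intro b hb
      simp [count_eq_zero (hX w.2) hb]
  simp only [h0 _ z hz, h0 _ z' hz', Finset.sum_mul_sum, Finset.expect_sum_comm]
  refine Finset.sum_congr rfl fun a _ => Finset.sum_congr rfl fun a' _ => ?_
  rw [← expect_prod_mul]
  exact Finset.expect_congr rfl fun w _ => by ring

lemma abs_fst_le_of_mem_merge {n : ℕ} {s p : ℝ} {A B : List (Entry n)} {c : Entry n}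
    (hc : c ∈ merge (p * (s / 2)) A B) : |c.1| ≤ ⌊s * p / 2⌋ := by
  obtain ⟨a, -, b, -, h, rfl⟩ := mem_merge.1 hc
  rw [Int.le_floor]
  push_cast at h ⊢
  linarith

lemma abs_cast_le_of_le_floor {s p : ℝ} {z : ℤ} (hz : |z| ≤ ⌊s * p / 2⌋) :
    |(z : ℝ)| ≤ p * (s / 2) := by
  rw [Int.le_floor] at hz
  push_cast at hz
  linarith

lemma mem_splittings {M z a : ℤ} : a ∈ splittings M z ↔ |a| ≤ M ∧ |z - a| ≤ M := by
  simp only [splittings, Finset.mem_filter, Finset.mem_Icc, abs_le]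

/-! ### The moments of the number of zeros -/

/-- If the expected counts of independent identically distributed lists lie between `lo / |⟨s⟩|` and
`hi / |⟨s⟩|`, as for lists of `lo` or `hi` uniform entries, then the expected number of zeros after
`l` rounds lies between the bounds for lists of these lengths. -/
theorem expect_count_loop {n : ℕ} {p : ℝ} (hp : 0 ≤ p) (hp1 : p ≤ 1) (l : ℕ) {Ω : Type}
    [Fintype Ω] {X : Ω → List (Entry n)} {s lo hi : ℝ} (hs : 0 ≤ s) (hlo : 0 ≤ lo)
    (hX : ∀ ω, ∀ a ∈ X ω, |a.1| ≤ ⌊s / 2⌋)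
    (h : ∀ z : ℤ, |z| ≤ ⌊s / 2⌋ → lo / rangeSize s ≤ 𝔼 ω, (count (X ω) z : ℝ) ∧
      𝔼 ω, (count (X ω) z : ℝ) ≤ hi / rangeSize s) :
    (firstMomentBounds s l lo p).2
        ≤ 𝔼 ω : Fin (2 ^ l) → Ω, (count (loop p l (s / 2) fun i => X (ω i)) 0 : ℝ) ∧
      𝔼 ω : Fin (2 ^ l) → Ω, (count (loop p l (s / 2) fun i => X (ω i)) 0 : ℝ)
        ≤ (firstMomentBounds s l hi p).1 := by
  have hM : 0 ≤ ⌊s / 2⌋ := Int.floor_nonneg.2 (by positivity)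
  induction l generalizing Ω s lo hi with
  | zero =>
    rw [expect_loop_zero (fun A => (count A 0 : ℝ))]
    simpa [firstMomentBounds, div_eq_mul_inv] using h 0 (by simpa using hM)
  | succ l ih =>
    have hD := rangeSize_pos hs
    have hE : 0 < rangeSize (s * p) := rangeSize_pos (by positivity)
    have hA := probSumInRange_pos hs hp hp1
    have hB := mrDistFromUnif_pos hs hp hp1
    rw [firstMomentBounds_succ_fst, firstMomentBounds_succ_snd,
      expect_loop_succ (fun A => (count A 0 : ℝ)), show p * (s / 2) = s * p / 2 by ring]
    refine ih (X := fun w : Ω × Ω => merge (s * p / 2) (X w.1) (X w.2)) (by positivity)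
      (by positivity) (fun w c hc => abs_fst_le_of_mem_merge (s := s) (p := p)
        (by rwa [show p * (s / 2) = s * p / 2 by ring])) (fun z hz => ?_)
      (Int.floor_nonneg.2 (by positivity))
    have htM : ⌊s * p / 2⌋ ≤ ⌊s / 2⌋ := Int.floor_le_floor (by nlinarith)
    have hz1 : |(z : ℝ)| ≤ s * p / 2 := by
      have := abs_cast_le_of_le_floor hz
      linarith
    have hz2 : |(z : ℝ)| ≤ (⌊s * p / 2⌋ : ℝ) := by exact_mod_cast hz
    rw [expect_count_merge hX hz1]
    have hcard := card_splittings_eq hs (hz.trans htM)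
    constructor
    · calc lo ^ 2 * (probSumInRange s p / mrDistFromUnif s p) / rangeSize (s * p)
          = lo ^ 2 * (probSumInRange s p / mrDistFromUnif s p / rangeSize (s * p)) := by ring
        _ ≤ lo ^ 2 * probSumToZ s z := by gcongr; exact le_probSumToZ hs hp hp1 hz2
        _ = (splittings ⌊s / 2⌋ z).card • (lo / rangeSize s * (lo / rangeSize s)) := by
          rw [nsmul_eq_mul, hcard]; field_simp
        _ ≤ _ := by
          refine Finset.card_nsmul_le_sum _ _ _ fun a ha => ?_
          obtain ⟨h1, h2⟩ := mem_splittings.1 ha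
          have := (h a h1).1
          have := (h _ h2).1
          gcongr
    · calc _ ≤ (splittings ⌊s / 2⌋ z).card • (hi / rangeSize s * (hi / rangeSize s)) := by
            refine Finset.sum_le_card_nsmul _ _ _ fun a ha => ?_
            obtain ⟨h1, h2⟩ := mem_splittings.1 ha
            have h3 : 0 ≤ lo / rangeSize s := by positivity
            have h4 := h a h1
            have h5 := h _ h2
            exact mul_le_mul h4.2 h5.2 (h3.trans h5.1) ((h3.trans h4.1).trans h4.2)
        _ = hi ^ 2 * probSumToZ s z := by
          rw [nsmul_eq_mul, hcard]; field_simp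
        _ ≤ hi ^ 2 * (probUnifXMRDist s p / rangeSize (s * p)) := by
          gcongr; exact probSumToZ_le hs hp hp1 z
        _ = _ := by ring

/-- The contribution to a second moment of the four ways in which a pair of sums can arise from
pairs that are either independent (weight `u`) or equal (weight `v`). -/
lemma sum_splittings_pair_le {S S' : Finset ℤ} {u v : ℝ} (hu : 0 ≤ u) (hv : 0 ≤ v) (z z' : ℤ) :
    ∑ a ∈ S, ∑ a' ∈ S', (u + if a = a' then v else 0) * (u + if z - a = z' - a' then v else 0)
      ≤ S.card * (S'.card * u ^ 2 + 2 * u * v + if z = z' then v ^ 2 else 0) := by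
  rw [← nsmul_eq_mul]
  refine Finset.sum_le_card_nsmul _ _ _ fun a _ => ?_
  have h1 : ∀ a', (u + if a = a' then v else 0) * (u + if z - a = z' - a' then v else 0)
      = u ^ 2 + (if a = a' then u * v else 0) + (if z' - z + a = a' then u * v else 0)
        + if a = a' then (if z = z' then v ^ 2 else 0) else 0 := by
    intro a'
    have e1 : z - a = z' - a' ↔ z' - z + a = a' := by omega
    simp only [e1]
    by_cases h : a = a'
    · have e2 : z' - z + a = a' ↔ z = z' := by omega
      simp only [h, if_true] at e2 ⊢
      simp only [e2]
      split_ifs <;> ring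
    · simp only [h, if_false]
      split_ifs <;> ring
  simp only [h1, Finset.sum_add_distrib, Finset.sum_const, nsmul_eq_mul, Finset.sum_ite_eq]
  have huv : 0 ≤ u * v := by positivity
  have hle : ∀ (P : Prop) [Decidable P] (x : ℝ), 0 ≤ x → (if P then x else 0) ≤ x := by
    intro P _ x hx
    split_ifs <;> simp [hx]
  have h2 := hle (a ∈ S') _ huv
  have h3 := hle (z' - z + a ∈ S') _ huv
  have h4 := hle (a ∈ S') (if z = z' then v ^ 2 else 0) (by positivity)
  linarith

/-- If the joint second moments of the counts of independent identically distributed lists are at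
most those of lists with `ν` uniform entries, then the second moment of the number of zeros after
`l` rounds is at most the bound for such lists. -/
theorem expect_count_sq_loop {n : ℕ} {p : ℝ} (hp : 0 ≤ p) (hp1 : p ≤ 1) (l : ℕ) {Ω : Type}
    [Fintype Ω] {X : Ω → List (Entry n)} {s ν : ℝ} (hs : 0 ≤ s) (hν : 0 ≤ ν)
    (hX : ∀ ω, ∀ a ∈ X ω, |a.1| ≤ ⌊s / 2⌋)
    (h : ∀ z z' : ℤ, |z| ≤ ⌊s / 2⌋ → |z'| ≤ ⌊s / 2⌋ →
      𝔼 ω, (count (X ω) z * count (X ω) z' : ℝ)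
        ≤ ν ^ 2 / rangeSize s ^ 2 + if z = z' then ν / rangeSize s else 0) :
    𝔼 ω : Fin (2 ^ l) → Ω, (count (loop p l (s / 2) fun i => X (ω i)) 0 : ℝ) ^ 2
      ≤ secondMomentUB p l s ν := by
  have hM : 0 ≤ ⌊s / 2⌋ := Int.floor_nonneg.2 (by positivity)
  induction l generalizing Ω s ν with
  | zero =>
    rw [expect_loop_zero (fun A => (count A 0 : ℝ) ^ 2)]
    simp only [sq]
    refine (h 0 0 (by simpa using hM) (by simpa using hM)).trans_eq ?_
    simp only [secondMomentUB, if_true]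
    ring
  | succ l ih =>
    have hD := rangeSize_pos hs
    have hE : 0 < rangeSize (s * p) := rangeSize_pos (by positivity)
    have hQ := probUnifXMRDist_pos hs hp hp1
    have hR := probUnifXMRDistPair_pos hs hp hp1
    rw [expect_loop_succ (fun A => (count A 0 : ℝ) ^ 2), secondMomentUB,
      show p * (s / 2) = s * p / 2 by ring]
    refine ih (X := fun w : Ω × Ω => merge (s * p / 2) (X w.1) (X w.2)) (by positivity)
      (by positivity) (fun w c hc => abs_fst_le_of_mem_merge (s := s) (p := p)
        (by rwa [show p * (s / 2) = s * p / 2 by ring])) (fun z z' hz hz' => ?_)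
      (Int.floor_nonneg.2 (by positivity))
    have htM : ⌊s * p / 2⌋ ≤ ⌊s / 2⌋ := Int.floor_le_floor (by nlinarith)
    have hz1 : ∀ {ζ : ℤ}, |ζ| ≤ ⌊s * p / 2⌋ → |(ζ : ℝ)| ≤ s * p / 2 := by
      intro ζ hζ
      have := abs_cast_le_of_le_floor hζ
      linarith
    rw [expect_count_mul_merge hX (hz1 hz) (hz1 hz')]
    have hcard := card_splittings_eq hs (hz.trans htM)
    have hcard' := card_splittings_eq hs (hz'.trans htM)
    have hP := probSumToZ_le hs hp hp1 z
    have hP' := probSumToZ_le hs hp hp1 z'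
    have hP0 : 0 < probSumToZ s z := probSumToZ_pos hs (by exact_mod_cast hz.trans htM)
    have hP0' : 0 < probSumToZ s z' := probSumToZ_pos hs (by exact_mod_cast hz'.trans htM)
    have hP1 : probSumToZ s z ≤ 1 / rangeSize s := by
      unfold probSumToZ
      have : 0 ≤ |(z : ℝ)| / rangeSize s ^ 2 := by positivity
      linarith
    have hpair := one_div_rangeSize_sq_le hs hp hp1
    -- equal pairs are counted with weight `ν'`, which dominates the true weight `A B ν²`
    have hsqrt : probUnifXMRDist s p * ν ^ 2
        ≤ √(probUnifXMRDist s p ^ 2 * ν ^ 4 + 2 * probUnifXMRDistPair s p * ν ^ 3) := by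
      refine Real.le_sqrt_of_sq_le ?_
      have : 0 ≤ 2 * probUnifXMRDistPair s p * ν ^ 3 := by positivity
      nlinarith
    have hu : 0 ≤ ν ^ 2 / rangeSize s ^ 2 := by positivity
    have hv : 0 ≤ ν / rangeSize s := by positivity
    have hterm : ∀ (P : Prop) [Decidable P] {x y : ℝ}, x ≤ y →
        (if P then x else 0) ≤ if P then y else 0 := by
      intro P _ x y hxy
      split_ifs <;> simp [hxy]
    calc _ ≤ ∑ a ∈ splittings ⌊s / 2⌋ z, ∑ a' ∈ splittings ⌊s / 2⌋ z',
            (ν ^ 2 / rangeSize s ^ 2 + if a = a' then ν / rangeSize s else 0)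
              * (ν ^ 2 / rangeSize s ^ 2 + if z - a = z' - a' then ν / rangeSize s else 0) := by
          refine Finset.sum_le_sum fun a ha => Finset.sum_le_sum fun a' ha' => ?_
          obtain ⟨h1, h2⟩ := mem_splittings.1 ha
          obtain ⟨h1', h2'⟩ := mem_splittings.1 ha'
          refine mul_le_mul (h _ _ h1 h1') (h _ _ h2 h2') ?_ (by positivity)
          exact Finset.expect_nonneg fun ω _ => by positivity
      _ ≤ _ := sum_splittings_pair_le hu hv z z'
      _ = ν ^ 4 * (probSumToZ s z * probSumToZ s z')
            + 2 * ν ^ 3 * (probSumToZ s z * (1 / rangeSize s))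
            + if z = z' then ν ^ 2 * probSumToZ s z else 0 := by
          rw [hcard, hcard']
          split_ifs
          · field_simp
          · field_simp
            ring
      _ ≤ ν ^ 4 * (probUnifXMRDist s p / rangeSize (s * p)
              * (probUnifXMRDist s p / rangeSize (s * p)))
            + 2 * ν ^ 3 * (probUnifXMRDistPair s p / rangeSize (s * p) ^ 2)
            + if z = z' then √(probUnifXMRDist s p ^ 2 * ν ^ 4
                + 2 * probUnifXMRDistPair s p * ν ^ 3) / rangeSize (s * p) else 0 := by
          refine add_le_add (add_le_add ?_ ?_) (hterm _ ?_)
          · gcongr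
          · gcongr
            refine le_trans ?_ hpair
            rw [sq, ← one_div_mul_one_div]
            gcongr
          · calc ν ^ 2 * probSumToZ s z
                ≤ ν ^ 2 * (probUnifXMRDist s p / rangeSize (s * p)) := by gcongr
              _ = probUnifXMRDist s p * ν ^ 2 / rangeSize (s * p) := by ring
              _ ≤ _ := by gcongr
      _ = _ := by
          rw [Real.sq_sqrt (by positivity)]
          congr 1
          field_simp

/-! ### Uniform input lists -/

lemma expect_pi_prod {ι V : Type*} [Fintype ι] [DecidableEq ι] [Fintype V] (f : ι → V → ℝ) :
    𝔼 ω : ι → V, ∏ i, f i (ω i) = ∏ i, 𝔼 v, f i v := by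
  simp only [Fintype.expect_eq_sum_div_card, Finset.prod_div_distrib, Finset.prod_univ_sum,
    Fintype.piFinset_univ, Finset.prod_const, Fintype.card_fun, Finset.card_univ, Nat.cast_pow]

lemma expect_apply {ι V : Type*} [Fintype ι] [DecidableEq ι] [Fintype V] [Nonempty V]
    (f : V → ℝ) (j : ι) : 𝔼 ω : ι → V, f (ω j) = 𝔼 v, f v := by
  have h := expect_pi_prod fun (i : ι) (v : V) => if i = j then f v else 1
  simp only [Finset.prod_ite_eq', Finset.mem_univ, if_true] at h
  rw [h]
  have h1 : ∀ i, (𝔼 v : V, if i = j then f v else 1) = if i = j then 𝔼 v, f v else 1 := by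
    intro i
    split_ifs <;> simp
  simp [h1]

lemma expect_apply_mul_apply {ι V : Type*} [Fintype ι] [DecidableEq ι] [Fintype V] [Nonempty V]
    (f g : V → ℝ) {j j' : ι} (hj : j ≠ j') :
    𝔼 ω : ι → V, f (ω j) * g (ω j') = (𝔼 v, f v) * 𝔼 v, g v := by
  have h := expect_pi_prod fun (i : ι) (v : V) =>
    (if i = j then f v else 1) * if i = j' then g v else 1
  simp only [Finset.prod_mul_distrib, Finset.prod_ite_eq', Finset.mem_univ, if_true] at h
  rw [h]
  have h1 : ∀ i, (𝔼 v : V, (if i = j then f v else 1) * if i = j' then g v else 1)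
      = (if i = j then 𝔼 v, f v else 1) * if i = j' then 𝔼 v, g v else 1 := by
    intro i
    by_cases h1 : i = j
    · simp [h1, hj]
    · by_cases h2 : i = j' <;> simp [h1, h2, hj.symm]
  rw [Finset.prod_congr rfl fun i _ => h1 i]
  rw [Finset.prod_mul_distrib]
  simp

lemma floor_half_natCast (m : ℕ) : ⌊(m : ℝ) / 2⌋ = ((m / 2 : ℕ) : ℤ) := by
  rw [Int.floor_eq_iff]
  have h : 2 * (m / 2) ≤ m ∧ m < 2 * (m / 2) + 2 := by omega
  have h1 : (2 * (m / 2 : ℕ) : ℝ) ≤ m := by exact_mod_cast h.1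
  have h2 : (m : ℝ) < 2 * (m / 2 : ℕ) + 2 := by exact_mod_cast h.2
  rw [Int.cast_natCast]
  constructor <;> linarith

lemma mem_range {m : ℕ} {z : ℤ} : z ∈ range m ↔ |z| ≤ ⌊(m : ℝ) / 2⌋ := by
  rw [floor_half_natCast, range, Finset.mem_Icc, abs_le]

instance (m : ℕ) : Nonempty {z : ℤ // z ∈ range m} :=
  ⟨⟨0, by rw [range, Finset.mem_Icc]; omega⟩⟩

lemma card_range (m : ℕ) : (Fintype.card {z : ℤ // z ∈ range m} : ℝ) = rangeSize m := by
  have : (range m).card = 2 * (m / 2) + 1 := by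
    rw [range, Int.card_Icc]
    omega
  rw [Fintype.card_coe, this, rangeSize, floor_half_natCast, Int.cast_natCast]
  push_cast
  ring

lemma expect_indicator {m : ℕ} {z : ℤ} (hz : |z| ≤ ⌊(m : ℝ) / 2⌋) :
    (𝔼 v : {z : ℤ // z ∈ range m}, if (v : ℤ) = z then (1 : ℝ) else 0) = 1 / rangeSize m := by
  rw [Fintype.expect_eq_sum_div_card, card_range]
  congr 1
  rw [Finset.sum_eq_single ⟨z, mem_range.2 hz⟩]
  · simp
  · intro b _ hb
    rw [if_neg fun h => hb (Subtype.ext h)]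
  · simp

/-- An input list as the algorithm stores it, with the index of each number. -/
def inputList {n m : ℕ} (ω : Fin n → {z : ℤ // z ∈ range m}) : List (Entry n) :=
  List.ofFn fun j => ((ω j : ℤ), [j])

lemma abs_fst_le_of_mem_inputList {n m : ℕ} (ω : Fin n → {z : ℤ // z ∈ range m}) :
    ∀ a ∈ inputList ω, |a.1| ≤ ⌊(m : ℝ) / 2⌋ := by
  intro a ha
  obtain ⟨j, rfl⟩ := List.mem_ofFn.1 ha
  exact mem_range.1 (ω j).2

lemma countP_ofFn {α : Type*} {n : ℕ} (q : α → Bool) (f : Fin n → α) :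
    (List.ofFn f).countP q = ∑ j, if q (f j) then 1 else 0 := by
  induction n with
  | zero => simp
  | succ n ih => rw [List.ofFn_succ, List.countP_cons, ih, Fin.sum_univ_succ, add_comm]

lemma count_inputList {n m : ℕ} (ω : Fin n → {z : ℤ // z ∈ range m}) (z : ℤ) :
    (count (inputList ω) z : ℝ) = ∑ j, if (ω j : ℤ) = z then (1 : ℝ) else 0 := by
  simp [count, inputList, countP_ofFn]

lemma expect_count_inputList {n m : ℕ} {z : ℤ} (hz : |z| ≤ ⌊(m : ℝ) / 2⌋) :
    𝔼 ω : Fin n → {z : ℤ // z ∈ range m}, (count (inputList ω) z : ℝ) = n / rangeSize m := by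
  simp only [count_inputList, Finset.expect_sum_comm]
  simp only [expect_apply fun v : {z : ℤ // z ∈ range m} => if (v : ℤ) = z then (1 : ℝ) else 0,
    expect_indicator hz]
  simp [div_eq_mul_inv]

lemma expect_count_mul_inputList_le {n m : ℕ} {z z' : ℤ} (hz : |z| ≤ ⌊(m : ℝ) / 2⌋)
    (hz' : |z'| ≤ ⌊(m : ℝ) / 2⌋) :
    𝔼 ω : Fin n → {z : ℤ // z ∈ range m},
        (count (inputList ω) z * count (inputList ω) z' : ℝ)
      ≤ (n : ℝ) ^ 2 / rangeSize m ^ 2 + if z = z' then (n : ℝ) / rangeSize m else 0 := by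
  have hD := rangeSize_pos (s := (m : ℝ)) (by positivity)
  simp only [count_inputList, Finset.sum_mul_sum, Finset.expect_sum_comm]
  calc _ ≤ ∑ j : Fin n, ∑ j' : Fin n, (1 / rangeSize m * (1 / rangeSize m)
          + if j = j' then (if z = z' then 1 / rangeSize m else 0) else 0) := by
        refine Finset.sum_le_sum fun j _ => Finset.sum_le_sum fun j' _ => ?_
        by_cases h : j = j'
        · subst h
          rw [expect_apply fun v : {z : ℤ // z ∈ range m} =>
            (if (v : ℤ) = z then (1 : ℝ) else 0) * if (v : ℤ) = z' then 1 else 0]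
          have h0 : 0 ≤ 1 / rangeSize m * (1 / rangeSize m) := by positivity
          by_cases h1 : z = z'
          · subst h1
            simp only [mul_ite, mul_one, mul_zero, if_true, ← ite_and, and_self,
              expect_indicator hz]
            linarith
          · have h2 : ∀ v : {z : ℤ // z ∈ range m},
                (if (v : ℤ) = z then (1 : ℝ) else 0) * (if (v : ℤ) = z' then 1 else 0) = 0 := by
              intro v
              split_ifs with h3 h4
              · exact absurd (h3.symm.trans h4) h1
              all_goals simp
            simp only [h2, h1, Finset.expect_const_zero, if_false, if_true, add_zero]
            exact h0
        · rw [expect_apply_mul_apply (fun v : {z : ℤ // z ∈ range m} =>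
              if (v : ℤ) = z then (1 : ℝ) else 0) (fun v => if (v : ℤ) = z' then 1 else 0) h,
            expect_indicator hz, expect_indicator hz']
          simp [h]
    _ = _ := by
        simp only [Finset.sum_add_distrib, Finset.sum_ite_eq, Finset.mem_univ, if_true,
          Finset.sum_const, Finset.card_univ, Fintype.card_fin, nsmul_eq_mul, mul_ite, mul_zero]
        congr 1
        · field_simp
        · simp [div_eq_mul_inv]

/-! ### Success probability and moments -/

lemma expectation_eq {k n m : ℕ} (X : Input k n m → ℝ) : expectation X = 𝔼 L, X L :=
  (Fintype.expect_eq_sum_div_card _).symm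

lemma successProb_eq (l n m : ℕ) (p : ℝ) :
    successProb l n m p = expectation fun L => if 0 < zeroCount l n m p L then (1 : ℝ) else 0 := by
  classical
  simp only [successProb, expectation, succeeds_iff, Fintype.card_subtype, Finset.sum_boole]

lemma successProb_le_expectation (l n m : ℕ) (p : ℝ) :
    successProb l n m p ≤ expectation fun L => (zeroCount l n m p L : ℝ) := by
  rw [successProb_eq, expectation_eq, expectation_eq]
  refine Finset.expect_le_expect fun L _ => ?_
  split_ifs with h
  · exact_mod_cast h
  · positivity

lemma successProb_le_one (l n m : ℕ) (p : ℝ) : successProb l n m p ≤ 1 := by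
  rw [successProb_eq, expectation_eq]
  refine (Finset.expect_le_expect fun L _ => ?_).trans_eq Fintype.expect_one
  split_ifs <;> norm_num

/-- The second moment method, that is, the Cauchy–Schwarz inequality for `C = C * 1_{C > 0}`. -/
lemma sq_expectation_le (l n m : ℕ) (p : ℝ) :
    expectation (fun L => (zeroCount l n m p L : ℝ)) ^ 2
      ≤ successProb l n m p * expectation fun L => (zeroCount l n m p L : ℝ) ^ 2 := by
  have h := Finset.sum_mul_sq_le_sq_mul_sq Finset.univ
    (fun L => if 0 < zeroCount l n m p L then (1 : ℝ) else 0)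
    (fun L => (zeroCount l n m p L : ℝ))
  have h1 : ∀ L, (if 0 < zeroCount l n m p L then (1 : ℝ) else 0) * (zeroCount l n m p L : ℝ)
      = zeroCount l n m p L := by
    intro L
    split_ifs with h
    · simp
    · simp [Nat.eq_zero_of_not_pos h]
  simp only [h1, ite_pow, one_pow, zero_pow two_ne_zero] at h
  rw [successProb_eq]
  simp only [expectation]
  rw [div_pow, div_mul_div_comm, ← sq]
  gcongr

/-- The two moment bounds, for the uniform input lists. -/
theorem moment_bounds {p : ℝ} (hp : 0 ≤ p) (hp1 : p ≤ 1) (l n m : ℕ) :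
    (firstMomentBounds m l n p).2 ≤ expectation (fun L => (zeroCount l n m p L : ℝ)) ∧
      expectation (fun L => (zeroCount l n m p L : ℝ)) ≤ (firstMomentBounds m l n p).1 ∧
      expectation (fun L => (zeroCount l n m p L : ℝ) ^ 2) ≤ secondMomentUB p l m n := by
  simp only [expectation_eq]
  have h1 := expect_count_loop hp hp1 l (X := inputList (n := n) (m := m)) (s := m) (lo := n)
    (hi := n) (by positivity) (by positivity) abs_fst_le_of_mem_inputList
    fun z hz => ⟨(expect_count_inputList hz).ge, (expect_count_inputList hz).le⟩
  have h2 := expect_count_sq_loop hp hp1 l (X := inputList (n := n) (m := m)) (s := m) (ν := n)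
    (by positivity) (by positivity) abs_fst_le_of_mem_inputList
    fun z z' hz hz' => expect_count_mul_inputList_le hz hz'
  exact ⟨h1.1, h1.2, h2⟩

theorem probBounds_snd_le_successProb {p : ℝ} (hp : 0 ≤ p) (hp1 : p ≤ 1) (l m : ℕ) {n : ℕ}
    (hn : 1 ≤ n) : (probBounds m l n p).2 ≤ successProb l n m p := by
  obtain ⟨h1, -, h3⟩ := moment_bounds hp hp1 l n m
  have h0 := firstMomentBounds_snd_nonneg hp hp1 l (s := (m : ℝ)) (ν := (n : ℝ)) (by positivity)
    (by positivity)
  have hU : 0 < secondMomentUB p l m n :=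
    secondMomentUB_pos hp hp1 l (by positivity) (by exact_mod_cast hn)
  have hP : 0 ≤ successProb l n m p := by
    unfold successProb
    positivity
  unfold probBounds
  rw [div_le_iff₀ hU]
  calc _ ≤ expectation (fun L => (zeroCount l n m p L : ℝ)) ^ 2 := by gcongr
    _ ≤ _ := sq_expectation_le l n m p
    _ ≤ _ := by gcongr

theorem successProb_le_probBounds_fst {p : ℝ} (hp : 0 ≤ p) (hp1 : p ≤ 1) (l n m : ℕ) :
    successProb l n m p ≤ (probBounds m l n p).1 :=
  le_min ((successProb_le_expectation l n m p).trans (moment_bounds hp hp1 l n m).2.1)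
    (successProb_le_one l n m p)

/-! ### Evaluation, definedness and cost of the expressions of the program -/

namespace Expr

section Basic

variable (σ : State) (f g : Expr)

@[simp] lemma eval_rd (r : Reg) : (rd r).eval σ = σ r := rfl
@[simp] lemma eval_add : (f + g).eval σ = f.eval σ + g.eval σ := rfl
@[simp] lemma eval_sub : (f - g).eval σ = f.eval σ - g.eval σ := rfl
@[simp] lemma eval_mul : (f * g).eval σ = f.eval σ * g.eval σ := rfl
@[simp] lemma eval_div : (f / g).eval σ = f.eval σ / g.eval σ := rfl
@[simp] lemma eval_max : (max f g).eval σ = Max.max (f.eval σ) (g.eval σ) := rfl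
@[simp] lemma eval_min : (min f g).eval σ = Min.min (f.eval σ) (g.eval σ) := rfl
@[simp] lemma eval_sqrt : (sqrt f).eval σ = √(f.eval σ) := rfl
@[simp] lemma eval_floor : (floor f).eval σ = (⌊f.eval σ⌋ : ℝ) := rfl
@[simp] lemma eval_zero : (0 : Expr).eval σ = 0 := Nat.cast_zero
@[simp] lemma eval_one : (1 : Expr).eval σ = 1 := Nat.cast_one
@[simp] lemma eval_two : (2 : Expr).eval σ = 2 := Nat.cast_ofNat
@[simp] lemma eval_six : (6 : Expr).eval σ = 6 := Nat.cast_ofNat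

@[simp] lemma defined_rd (r : Reg) : (rd r).Defined σ := trivial
@[simp] lemma defined_add : (f + g).Defined σ ↔ f.Defined σ ∧ g.Defined σ := Iff.rfl
@[simp] lemma defined_sub : (f - g).Defined σ ↔ f.Defined σ ∧ g.Defined σ := Iff.rfl
@[simp] lemma defined_mul : (f * g).Defined σ ↔ f.Defined σ ∧ g.Defined σ := Iff.rfl
@[simp] lemma defined_div :
    (f / g).Defined σ ↔ f.Defined σ ∧ g.Defined σ ∧ g.eval σ ≠ 0 := Iff.rfl
@[simp] lemma defined_max : (max f g).Defined σ ↔ f.Defined σ ∧ g.Defined σ := Iff.rfl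
@[simp] lemma defined_min : (min f g).Defined σ ↔ f.Defined σ ∧ g.Defined σ := Iff.rfl
@[simp] lemma defined_sqrt : (sqrt f).Defined σ ↔ f.Defined σ ∧ 0 ≤ f.eval σ := Iff.rfl
@[simp] lemma defined_floor : (floor f).Defined σ ↔ f.Defined σ := Iff.rfl
@[simp] lemma defined_zero : (0 : Expr).Defined σ := trivial
@[simp] lemma defined_one : (1 : Expr).Defined σ := trivial
@[simp] lemma defined_two : (2 : Expr).Defined σ := trivial
@[simp] lemma defined_six : (6 : Expr).Defined σ := trivial

@[simp] lemma cost_rd (r : Reg) : (rd r).cost σ = 1 := rfl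
@[simp] lemma cost_add : (f + g).cost σ = f.cost σ + g.cost σ + 1 := rfl
@[simp] lemma cost_sub : (f - g).cost σ = f.cost σ + g.cost σ + 1 := rfl
@[simp] lemma cost_mul : (f * g).cost σ = f.cost σ + g.cost σ + 1 := rfl
@[simp] lemma cost_div : (f / g).cost σ = f.cost σ + g.cost σ + 1 := rfl
@[simp] lemma cost_max : (max f g).cost σ = f.cost σ + g.cost σ + 1 := rfl
@[simp] lemma cost_min : (min f g).cost σ = f.cost σ + g.cost σ + 1 := rfl
@[simp] lemma cost_sqrt : (sqrt f).cost σ = f.cost σ + 1 := rfl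
@[simp] lemma cost_floor : (floor f).cost σ = f.cost σ + 1 + Nat.size ⌊|f.eval σ|⌋₊ := rfl
@[simp] lemma cost_zero : (0 : Expr).cost σ = 1 := rfl
@[simp] lemma cost_one : (1 : Expr).cost σ = 1 := rfl
@[simp] lemma cost_two : (2 : Expr).cost σ = 1 := rfl
@[simp] lemma cost_six : (6 : Expr).cost σ = 1 := rfl

@[simp] lemma eval_rangeSize : (rangeSize f).eval σ = KTree.rangeSize (f.eval σ) := by
  simp [rangeSize, KTree.rangeSize]

@[simp] lemma eval_sq : (sq f).eval σ = f.eval σ ^ 2 := by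
  simp [Expr.sq, pow_two]

@[simp] lemma eval_cube : (cube f).eval σ = f.eval σ ^ 3 := by
  simp [cube, pow_succ]

@[simp] lemma eval_abs : (abs f).eval σ = |f.eval σ| := by
  simp [Expr.abs, abs_eq_max_neg]

@[simp] lemma eval_probSumToZ :
    (probSumToZ f g).eval σ = KTree.probSumToZ (f.eval σ) (g.eval σ) := by
  simp [probSumToZ, KTree.probSumToZ]

@[simp] lemma eval_probSumInRange :
    (probSumInRange f g).eval σ = KTree.probSumInRange (f.eval σ) (g.eval σ) := by
  simp [probSumInRange, KTree.probSumInRange]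

@[simp] lemma eval_mrDistFromUnif :
    (mrDistFromUnif f g).eval σ = KTree.mrDistFromUnif (f.eval σ) (g.eval σ) := by
  simp [mrDistFromUnif, KTree.mrDistFromUnif]

@[simp] lemma eval_probSumWithTwoRVInRange :
    (probSumWithTwoRVInRange f g).eval σ
      = KTree.probSumWithTwoRVInRange (f.eval σ) (g.eval σ) := by
  simp [probSumWithTwoRVInRange, KTree.probSumWithTwoRVInRange]

@[simp] lemma eval_mrDistFromPairUnif :
    (mrDistFromPairUnif f g).eval σ = KTree.mrDistFromPairUnif (f.eval σ) (g.eval σ) := by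
  simp [mrDistFromPairUnif, KTree.mrDistFromPairUnif]

@[simp] lemma eval_probUnifXMRDist :
    (probUnifXMRDist f g).eval σ = KTree.probUnifXMRDist (f.eval σ) (g.eval σ) := by
  simp [probUnifXMRDist, KTree.probUnifXMRDist]

@[simp] lemma eval_probUnifXMRDistPair :
    (probUnifXMRDistPair f g).eval σ = KTree.probUnifXMRDistPair (f.eval σ) (g.eval σ) := by
  simp [probUnifXMRDistPair, KTree.probUnifXMRDistPair]

end Basic

section Level

variable {σ : State} {f g : Expr}

lemma defined_rangeSize (hf : f.Defined σ) : (rangeSize f).Defined σ := by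
  simp [rangeSize, hf]

variable (hf : f.Defined σ) (hg : g.Defined σ) (hs : 0 ≤ f.eval σ) (hp : 0 ≤ g.eval σ)
  (hp1 : g.eval σ ≤ 1)

include hf hs

lemma defined_probSumToZ (hg : g.Defined σ) : (probSumToZ f g).Defined σ := by
  have := (rangeSize_pos hs).ne'
  simp [probSumToZ, Expr.abs, Expr.sq, defined_rangeSize hf, hg, this]

include hg

lemma defined_probSumInRange : (probSumInRange f g).Defined σ := by
  have := (rangeSize_pos hs).ne'
  simp [probSumInRange, Expr.sq, defined_rangeSize hf, hf, hg, this]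

lemma defined_probSumWithTwoRVInRange : (probSumWithTwoRVInRange f g).Defined σ := by
  have h1 := (rangeSize_pos hs).ne'
  have h4 : (f * g).Defined σ := by simp [hf, hg]
  simp [probSumWithTwoRVInRange, Expr.sq, cube, defined_rangeSize hf, defined_rangeSize h4, hf, hg,
    h1]

include hp hp1

lemma defined_mrDistFromUnif : (mrDistFromUnif f g).Defined σ := by
  have h1 := (probSumInRange_pos hs hp hp1).ne'
  have h2 := (probSumToZ_half_pos hs hp hp1).ne'
  have h3 := (rangeSize_pos (mul_nonneg hs hp)).ne'
  have h4 : (f * g).Defined σ := by simp [hf, hg]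
  simp [mrDistFromUnif, defined_probSumInRange hf hg hs, defined_probSumToZ hf hs,
    defined_rangeSize h4, hf, hg, h1, h2, h3]

lemma defined_mrDistFromPairUnif : (mrDistFromPairUnif f g).Defined σ := by
  have h1 := (rangeSize_pos hs).ne'
  have h2 := (probSumWithTwoRVInRange_pos hs hp hp1).ne'
  have h3 := (rangeSize_pos (mul_nonneg hs hp)).ne'
  have h4 : (f * g).Defined σ := by simp [hf, hg]
  -- the last denominator is the quotient `β`, whose numerator is at least `1`
  have h5 : (2 * ((⌊f.eval σ / 2⌋ : ℝ) - ⌊f.eval σ * g.eval σ / 2⌋) + 1) ≠ 0 := by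
    have := (half_floor_bounds hs hp hp1).2
    linarith
  simp [mrDistFromPairUnif, Expr.sq, cube, defined_rangeSize hf, defined_rangeSize h4, hf, hg,
    defined_probSumWithTwoRVInRange hf hg hs, h1, h2, h3, h5]

lemma defined_probUnifXMRDist : (probUnifXMRDist f g).Defined σ :=
  ⟨defined_probSumInRange hf hg hs, defined_mrDistFromUnif hf hg hs hp hp1⟩

lemma defined_probUnifXMRDistPair : (probUnifXMRDistPair f g).Defined σ :=
  ⟨defined_probSumWithTwoRVInRange hf hg hs, defined_mrDistFromPairUnif hf hg hs hp hp1⟩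

end Level

section Cost

variable {σ : State} {r q : Reg} {M : ℕ}

/-- All numbers that are rounded down at a level are at most the parameter `m`. -/
lemma size_floor_le (hs : 0 ≤ σ r) (hM : σ r ≤ M) (hp : 0 ≤ σ q) (hp1 : σ q ≤ 1) :
    Nat.size ⌊|σ r / 2|⌋₊ ≤ Nat.size M ∧ Nat.size ⌊|σ r * σ q / 2|⌋₊ ≤ Nat.size M := by
  constructor <;> refine Nat.size_le_size (Nat.floor_le_of_le ?_)
  · rw [abs_of_nonneg (by positivity)]
    linarith
  · rw [abs_of_nonneg (by positivity)]
    nlinarith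

variable (hs : 0 ≤ σ r) (hM : σ r ≤ M) (hp : 0 ≤ σ q) (hp1 : σ q ≤ 1)

include hs hM hp hp1

lemma cost_probSumInRange_le :
    (probSumInRange (rd r) (rd q)).cost σ ≤ 100 * (Nat.size M + 1) := by
  obtain ⟨h1, h2⟩ := size_floor_le hs hM hp hp1
  simp only [probSumInRange, rangeSize, Expr.sq, cost_rd, cost_add, cost_sub, cost_mul, cost_div,
    cost_floor, cost_one, cost_two, eval_rd, eval_mul, eval_div, eval_two]
  omega

lemma cost_mrDistFromUnif_le :
    (mrDistFromUnif (rd r) (rd q)).cost σ ≤ 500 * (Nat.size M + 1) := by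
  obtain ⟨h1, h2⟩ := size_floor_le hs hM hp hp1
  have h3 := cost_probSumInRange_le hs hM hp hp1
  simp only [mrDistFromUnif, probSumToZ, Expr.abs, rangeSize, Expr.sq, cost_rd, cost_add, cost_sub,
    cost_mul, cost_div, cost_max, cost_floor, cost_zero, cost_one, cost_two, eval_rd, eval_mul,
    eval_div, eval_two]
  omega

lemma cost_probSumWithTwoRVInRange_le :
    (probSumWithTwoRVInRange (rd r) (rd q)).cost σ ≤ 500 * (Nat.size M + 1) := by
  obtain ⟨h1, h2⟩ := size_floor_le hs hM hp hp1
  simp only [probSumWithTwoRVInRange, rangeSize, Expr.sq, cube, cost_rd, cost_add, cost_sub,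
    cost_mul, cost_div, cost_floor, cost_one, cost_two, cost_six, eval_rd, eval_mul, eval_div,
    eval_two]
  omega

lemma cost_mrDistFromPairUnif_le :
    (mrDistFromPairUnif (rd r) (rd q)).cost σ ≤ 1500 * (Nat.size M + 1) := by
  obtain ⟨h1, h2⟩ := size_floor_le hs hM hp hp1
  have h3 := cost_probSumWithTwoRVInRange_le hs hM hp hp1
  simp only [mrDistFromPairUnif, rangeSize, Expr.sq, cube, cost_rd, cost_add, cost_sub,
    cost_mul, cost_div, cost_max, cost_floor, cost_one, cost_two, eval_rd, eval_mul, eval_div,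
    eval_two]
  omega

end Cost

end Expr

/-! ### Total correctness with a bound on the number of steps -/

/-- Started in the state `σ`, the command `c` terminates after at most `T` steps in a state that
satisfies `P`. -/
def Terminates (c : Cmd) (σ : State) (T : ℕ) (P : State → Prop) : Prop :=
  ∃ τ t, Exec c σ τ t ∧ t ≤ T ∧ P τ

lemma Terminates.mono {c : Cmd} {σ : State} {S T : ℕ} {P Q : State → Prop}
    (h : Terminates c σ S P) (hST : S ≤ T) (hPQ : ∀ τ, P τ → Q τ) : Terminates c σ T Q := by
  obtain ⟨τ, t, hc, ht, hP⟩ := h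
  exact ⟨τ, t, hc, ht.trans hST, hPQ τ hP⟩

lemma Terminates.assign {r : Reg} {f : Expr} {σ : State} {T : ℕ} {P : State → Prop}
    (hf : f.Defined σ) (hT : f.cost σ + 1 ≤ T) (hP : P (Function.update σ r (f.eval σ))) :
    Terminates (r ≔ f) σ T P :=
  ⟨_, _, Exec.assign r f σ hf, hT, hP⟩

lemma Terminates.seq {c₁ c₂ : Cmd} {σ : State} {S T : ℕ} {P Q : State → Prop}
    (h₁ : Terminates c₁ σ S P) (h₂ : ∀ τ, P τ → Terminates c₂ τ T Q) :
    Terminates (c₁ ;; c₂) σ (S + T) Q := by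
  obtain ⟨τ, s, hc, hs, hP⟩ := h₁
  obtain ⟨ρ, t, hd, ht, hQ⟩ := h₂ τ hP
  exact ⟨ρ, s + t, Exec.seq _ _ _ _ _ _ _ hc hd, by omega, hQ⟩

/-- A loop that runs `N` times, with an invariant that depends on the number of runs so far. -/
lemma Terminates.whileLT {f g : Expr} {body : Cmd} {σ : State} (N T U : ℕ)
    (I : ℕ → State → Prop) (h0 : I 0 σ)
    (htest : ∀ i τ, i ≤ N → I i τ → f.Defined τ ∧ g.Defined τ ∧ f.cost τ + g.cost τ + 1 ≤ U ∧
      (f.eval τ < g.eval τ ↔ i < N))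
    (hbody : ∀ i τ, i < N → I i τ → Terminates body τ T (I (i + 1))) :
    Terminates (Cmd.whileLT f g body) σ (N * (U + T) + U) (I N) := by
  suffices h : ∀ j i τ, i + j = N → I i τ →
      Terminates (Cmd.whileLT f g body) τ (j * (U + T) + U) (I N) from h N 0 σ (zero_add N) h0
  intro j
  induction j with
  | zero =>
    intro i τ hi hI
    obtain rfl : i = N := hi
    obtain ⟨hf, hg, hU, h⟩ := htest i τ le_rfl hI
    exact ⟨τ, _, Exec.whileStop _ _ _ _ hf hg (by simp [h]), by omega, hI⟩
  | succ j ih =>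
    intro i τ hi hI
    obtain ⟨hf, hg, hU, h⟩ := htest i τ (by omega) hI
    obtain ⟨ρ, s, hs, hsT, hI'⟩ := hbody i τ (by omega) hI
    obtain ⟨ρ', t, ht, htT, hN⟩ := ih (i + 1) ρ (by omega) hI'
    refine ⟨ρ', _, Exec.whileStep _ _ _ _ _ _ _ _ hf hg (h.2 (by omega)) hs ht, ?_, hN⟩
    rw [add_mul, one_mul]
    omega

lemma one_lt_two_pow_iff {j : ℕ} : 1 < (2 : ℝ) ^ j ↔ 0 < j := by
  simpa using pow_lt_pow_iff_right₀ (one_lt_two (α := ℝ)) (n := 0) (m := j)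

open Reg
open KTree.Expr (rd)

/-- `powNat` leaves `b ^ N` in `r` and `0` in its counter `e`, and changes no other register. The
base must not depend on `r` and `e`, since it is evaluated again in every run of the loop. -/
lemma terminates_powNat {r : Reg} {f g : Expr} {σ : State} {b : ℝ} {N T : ℕ} (hr : r ≠ e)
    (hf : ∀ u v, f.Defined (Function.update (Function.update σ r u) e v) ∧
      f.eval (Function.update (Function.update σ r u) e v) = b ∧
      f.cost (Function.update (Function.update σ r u) e v) = 1)
    (hg : g.Defined (Function.update σ r 1)) (hgN : g.eval (Function.update σ r 1) = N)
    (hT : g.cost (Function.update σ r 1) + 20 * (N + 1) ≤ T) :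
    Terminates (powNat r f g) σ T
      (fun τ => τ = Function.update (Function.update σ r (b ^ N)) e 0) := by
  have hloop := Terminates.whileLT (f := 0) (g := rd e) (body := (r ≔ rd r * f ;; e ≔ rd e - 1))
    (σ := Function.update (Function.update σ r 1) e N) N (6 + 6) 3
    (fun i τ => τ = Function.update (Function.update σ r (b ^ i)) e ((N : ℝ) - i))
    (by simp) (fun i τ hi hI => ⟨trivial, trivial, le_rfl, by simp [hI]⟩)
    (fun i τ hi hI => by
      subst hI
      obtain ⟨h1, h2, h3⟩ := hf (b ^ i) ((N : ℝ) - i)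
      refine Terminates.seq (P := fun τ => τ = Function.update (Function.update σ r (b ^ (i + 1)))
        e ((N : ℝ) - i)) (Terminates.assign (by simp [h1]) (by simp [h3]) ?_) ?_
      · funext ρ
        by_cases h : ρ = r
        · subst h; simp [hr, h2, pow_succ]
        · simp [Function.update_apply, h]
      · rintro _ rfl
        refine Terminates.assign (by simp) (by simp) ?_
        funext ρ
        by_cases h : ρ = e
        · subst h; simp; ring
        · simp [Function.update_apply, h])
  refine Terminates.mono (Terminates.seq (S := 2) (P := fun τ => τ = Function.update σ r 1)
    (Terminates.assign (by simp) (by simp) (by simp)) (Q := fun τ => τ = Function.update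
      (Function.update σ r (b ^ N)) e 0)
      (T := g.cost (Function.update σ r 1) + 1 + (N * (3 + (6 + 6)) + 3)) ?_) (by omega)
      fun _ h => h
  rintro _ rfl
  refine Terminates.seq (P := fun τ => τ = Function.update (Function.update σ r 1) e N)
    (Terminates.assign hg le_rfl (by rw [hgN])) ?_
  rintro _ rfl
  exact hloop.mono le_rfl fun τ h => by rw [h, sub_self]

/-- `powTwo` leaves `b ^ 2 ^ N` in `r` and `1` in its counter `e`, and changes no other register. -/
lemma terminates_powTwo {r : Reg} {f g : Expr} {σ : State} {b : ℝ} {N T : ℕ} (hr : r ≠ e)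
    (hf : f.Defined σ) (hfb : f.eval σ = b)
    (hg : g.Defined (Function.update σ r b)) (hgN : g.eval (Function.update σ r b) = 2 ^ N)
    (hT : f.cost σ + g.cost (Function.update σ r b) + 20 * (N + 1) ≤ T) :
    Terminates (powTwo r f g) σ T
      (fun τ => τ = Function.update (Function.update σ r (b ^ 2 ^ N)) e 1) := by
  have hloop := Terminates.whileLT (f := 1) (g := rd e) (body := (r ≔ rd r * rd r ;; e ≔ rd e / 2))
    (σ := Function.update (Function.update σ r b) e (2 ^ N)) N (6 + 6) 3
    (fun i τ => i ≤ N → τ = Function.update (Function.update σ r (b ^ 2 ^ i)) e (2 ^ (N - i)))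
    (by simp)
    (fun i τ hi hI => ⟨trivial, trivial, le_rfl, by
      rw [hI hi]
      simp [one_lt_two_pow_iff]⟩)
    (fun i τ hi hI => by
      obtain rfl := hI hi.le
      refine Terminates.seq (P := fun τ => τ = Function.update
        (Function.update σ r (b ^ 2 ^ (i + 1))) e (2 ^ (N - i)))
        (Terminates.assign (by simp) (by simp) ?_) ?_
      · funext ρ
        by_cases h : ρ = r
        · subst h; simp [hr, pow_succ, pow_mul]
        · simp [Function.update_apply, h]
      · rintro _ rfl
        refine Terminates.assign (by simp) (by simp) fun _ => ?_
        funext ρ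
        by_cases h : ρ = e
        · subst h
          obtain ⟨j, hj⟩ : ∃ j, N - i = j + 1 := ⟨N - i - 1, by omega⟩
          simp [hj, show N - (i + 1) = j by omega, pow_succ]
        · simp [Function.update_apply, h])
  refine Terminates.mono (Terminates.seq (S := f.cost σ + 1)
    (P := fun τ => τ = Function.update σ r b)
    (Terminates.assign hf le_rfl (by rw [hfb])) (Q := fun τ => τ = Function.update
      (Function.update σ r (b ^ 2 ^ N)) e 1)
      (T := g.cost (Function.update σ r b) + 1 + (N * (3 + (6 + 6)) + 3)) ?_) (by omega)
      fun _ h => h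
  rintro _ rfl
  refine Terminates.seq (P := fun τ => τ = Function.update (Function.update σ r b) e (2 ^ N))
    (Terminates.assign hg le_rfl (by rw [hgN])) ?_
  rintro _ rfl
  exact hloop.mono le_rfl fun τ h => by rw [h le_rfl, Nat.sub_self, pow_zero]

/-! ### Correctness and running time of the program -/

lemma firstMomentInductFactors_eq {s p : ℝ} {l d : ℕ} (hd : d < l) :
    firstMomentInductFactors s l p d
      = (probSumInRange (s * p ^ d) p ^ 2 ^ (l - (d + 1))
          * mrDistFromUnif (s * p ^ d) p ^ 2 ^ (l - (d + 1)),
        probSumInRange (s * p ^ d) p ^ 2 ^ (l - (d + 1))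
          / mrDistFromUnif (s * p ^ d) p ^ 2 ^ (l - (d + 1))) := by
  simp only [firstMomentInductFactors, Nat.pow_div (show d + 1 ≤ l from hd) two_pos]

lemma terminates_firstMomentInductFactorsCmd {σ : State} {M l i : ℕ} {π : ℝ} (hm : σ m = M)
    (hk : σ k = 2 ^ l) (hp : σ p = π) (hd : σ d = i) (hπ : 0 ≤ π) (hπ1 : π ≤ 1) (hi : i < l) :
    Terminates firstMomentInductFactorsCmd σ (5000 * (Nat.size M + l + 1)) (fun τ =>
      τ a = (firstMomentInductFactors M l π i).1 ∧ τ b = (firstMomentInductFactors M l π i).2 ∧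
      ∀ r, r ≠ x → r ≠ y → r ≠ a → r ≠ b → r ≠ s → r ≠ e → τ r = σ r) := by
  have hs : 0 ≤ (M : ℝ) * π ^ i := by positivity
  have hsM : (M : ℝ) * π ^ i ≤ M :=
    mul_le_of_le_one_right (by positivity) (pow_le_one₀ hπ hπ1)
  have hexp : (2 : ℝ) ^ l / 2 ^ (i + 1) = 2 ^ (l - (i + 1)) := by
    rw [div_eq_iff (by positivity), ← pow_add, Nat.sub_add_cancel hi]
  set Y := Nat.size M + l + 1 with hY
  refine Terminates.mono (S := 100 * Y + (100 * Y + (100 * Y + (1000 * Y + (1000 * Y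
    + (100 * Y + (100 * Y + 100 * Y)))))))
    (P := fun τ => τ a = (firstMomentInductFactors M l π i).1 ∧
      τ b = (firstMomentInductFactors M l π i).2 ∧
      ∀ r, r ≠ x → r ≠ y → r ≠ a → r ≠ b → r ≠ s → r ≠ e → τ r = σ r)
    ?_ (by omega) fun _ h => h
  refine Terminates.seq (terminates_powNat (b := π) (N := i) (by decide) (by simp [hp]) (by simp)
    (by simp [hd]) (by simp; omega)) ?_
  rintro _ rfl
  refine Terminates.seq (P := fun τ => τ s = M * π ^ i ∧
    ∀ r, r ≠ x → r ≠ s → r ≠ e → τ r = σ r)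
    (Terminates.assign (by simp) (by simp; omega) ⟨by simp [hm], fun r h1 h2 h3 => by
      simp [Function.update_of_ne, h1, h2, h3]⟩) ?_
  rintro σ₁ ⟨hs1, h1⟩
  refine Terminates.seq (terminates_powNat (b := 2) (N := i + 1) (by decide) (by simp) (by simp)
    (by simp [h1, hd]) (by simp; omega)) ?_
  rintro _ rfl
  refine Terminates.seq (terminates_powTwo (b := probSumInRange (M * π ^ i) π)
    (N := l - (i + 1)) (by decide)
    (Expr.defined_probSumInRange (by simp) (by simp) (by simpa [hs1] using hs))
    (by simp [hs1, h1, hp]) (by simp)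
    (by simp [h1, hk, hexp]) ?_) ?_
  · refine (add_le_add_left (add_le_add (Expr.cost_probSumInRange_le (M := M) (by simpa [hs1])
      (by simpa [hs1]) (by simpa [h1, hp]) (by simpa [h1, hp])) le_rfl) _).trans ?_
    simp
    omega
  rintro _ rfl
  refine Terminates.seq (terminates_powTwo (b := mrDistFromUnif (M * π ^ i) π)
    (N := l - (i + 1)) (by decide)
    (Expr.defined_mrDistFromUnif (by simp) (by simp) (by simpa [hs1] using hs)
      (by simpa [h1, hp]) (by simpa [h1, hp]))
    (by simp [hs1, h1, hp]) (by simp)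
    (by simp [h1, hk, hexp]) ?_) ?_
  · refine (add_le_add_left (add_le_add (Expr.cost_mrDistFromUnif_le (M := M) (by simpa [hs1])
      (by simpa [hs1]) (by simpa [h1, hp]) (by simpa [h1, hp])) le_rfl) _).trans ?_
    simp
    omega
  rintro _ rfl
  have hB := mrDistFromUnif_pos hs hπ hπ1
  refine Terminates.seq (Terminates.assign (P := fun τ => τ = _) (by simp) (by simp; omega) rfl) ?_
  rintro _ rfl
  refine Terminates.seq (Terminates.assign (P := fun τ => τ = _) (by simp [hB.ne'])
    (by simp; omega) rfl) ?_
  rintro _ rfl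
  refine Terminates.assign (by simp) (by simp; omega) ⟨?_, ?_, ?_⟩
  · simp [firstMomentInductFactors_eq hi]
  · simp [firstMomentInductFactors_eq hi]
  · intro r hx hy ha hb hs' he
    simp [hx, hy, ha, hb, he, h1 r hx hs' he]

/-- The input registers still hold the input. -/
def HoldsInput (M l : ℕ) (ν π : ℝ) (σ : State) : Prop :=
  σ m = M ∧ σ k = 2 ^ l ∧ σ n = ν ∧ σ p = π

lemma HoldsInput.congr {M l : ℕ} {ν π : ℝ} {σ τ : State} (h : HoldsInput M l ν π σ)
    (hm : τ m = σ m) (hk : τ k = σ k) (hn : τ n = σ n) (hp : τ p = σ p) :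
    HoldsInput M l ν π τ := by
  unfold HoldsInput
  rwa [hm, hk, hn, hp]

lemma terminates_firstMomentBoundsCmd {σ : State} {M l : ℕ} {ν π : ℝ} (hπ : 0 ≤ π) (hπ1 : π ≤ 1)
    (hin : HoldsInput M l ν π σ) :
    Terminates firstMomentBoundsCmd σ (7000 * (Nat.size M + l + 1) ^ 2) (fun τ =>
      HoldsInput M l ν π τ ∧ τ u₁ = (firstMomentBounds M l ν π).1 ∧
      τ l₁ = (firstMomentBounds M l ν π).2) := by
  have hs : 0 ≤ (M : ℝ) * π ^ l := by positivity
  have hπl : 0 ≤ π ^ l := by positivity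
  have hπl1 : π ^ l ≤ 1 := pow_le_one₀ hπ hπ1
  have hD := rangeSize_pos hs
  set Y := Nat.size M + l + 1 with hY
  have hlY : l * (3 + (5000 * Y + (100 + (100 + 100)))) ≤ Y * (6000 * Y) :=
    Nat.mul_le_mul (by omega) (by omega)
  have hYY : Y ≤ Y ^ 2 := Nat.le_self_pow two_ne_zero Y
  have hYY' : Y * (6000 * Y) = 6000 * Y ^ 2 := by ring
  refine Terminates.mono (S := 100 * Y + (100 * Y + (100 * Y + (100 * Y + (100 * Y
    + (100 * Y + (100 * Y + (100 * Y + (l * (3 + (5000 * Y + (100 + (100 + 100)))) + 3)))))))))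
    (P := fun τ =>
      HoldsInput M l ν π τ ∧ τ u₁ = (firstMomentBounds M l ν π).1 ∧
      τ l₁ = (firstMomentBounds M l ν π).2) ?_ (by omega) fun _ h => h
  refine Terminates.seq (Terminates.assign (P := fun τ => HoldsInput M l ν π τ ∧ τ logk = 0)
    (by simp) (by simp; omega) ⟨hin.congr rfl rfl rfl rfl, by simp⟩) ?_
  rintro σ₁ ⟨h1, hlog1⟩
  refine Terminates.seq (Terminates.assign
    (P := fun τ => HoldsInput M l ν π τ ∧ τ logk = 0 ∧ τ e = 2 ^ l)
    (by simp) (by simp; omega) ⟨h1.congr rfl rfl rfl rfl, by simpa, by simpa using h1.2.1⟩) ?_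
  rintro σ₂ ⟨h2, hlog2, he2⟩
  refine Terminates.seq ((Terminates.whileLT l (6 + 6) 3
    (fun i τ => HoldsInput M l ν π τ ∧ τ logk = i ∧ (i ≤ l → τ e = 2 ^ (l - i)))
    ⟨h2, by simpa using hlog2, fun _ => by simpa using he2⟩
    (fun i τ hi hI => ⟨by simp, by simp, by simp, by
      simp [hI.2.2 hi, one_lt_two_pow_iff]⟩)
    (fun i τ hi hI => by
      refine Terminates.seq (Terminates.assign (P := fun τ => HoldsInput M l ν π τ ∧ τ logk = i ∧
        τ e = 2 ^ (l - (i + 1))) (by simp) (by simp)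
        ⟨hI.1.congr rfl rfl rfl rfl, by simpa using hI.2.1, ?_⟩) ?_
      · obtain ⟨j, hj⟩ : ∃ j, l - i = j + 1 := ⟨l - i - 1, by omega⟩
        simp [hI.2.2 hi.le, hj, show l - (i + 1) = j by omega, pow_succ]
      · rintro τ' ⟨h1, h2, h3⟩
        exact Terminates.assign (by simp) (by simp)
          ⟨h1.congr rfl rfl rfl rfl, by simp [h2], fun _ => by simpa using h3⟩)).mono
    (T := 100 * Y) (by omega) fun _ h => h) ?_
  rintro σ₃ ⟨h3, hlog3, -⟩
  refine Terminates.seq (terminates_powNat (b := π) (N := l) (by decide) (by simp [h3.2.2.2])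
    (by simp) (by simp [hlog3]) (by simp; omega)) ?_
  rintro _ rfl
  refine Terminates.seq (terminates_powTwo (b := ν) (N := l) (by decide) (by simp)
    (by simp [h3.2.2.1]) (by simp) (by simp [h3.2.1]) (by simp; omega)) ?_
  rintro _ rfl
  refine Terminates.seq (Terminates.assign (P := fun τ => HoldsInput M l ν π τ ∧ τ logk = l ∧
    τ u₁ = ν ^ 2 ^ l * (1 / rangeSize (M * π ^ l)))
    ?_ ?_ ⟨h3.congr rfl rfl rfl rfl, by simpa using hlog3, by simp [h3.1]⟩) ?_
  · have : (rd m * rd x).Defined (Function.update (Function.update (Function.update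
      (Function.update σ₃ x (π ^ l)) e 0) u₁ (ν ^ 2 ^ l)) e 1) := by simp
    simp [Expr.defined_rangeSize this, h3.1, hD.ne']
  · have := (Expr.size_floor_le (r := m) (q := x) (M := M) (σ := Function.update (Function.update
      (Function.update (Function.update σ₃ x (π ^ l)) e 0) u₁ (ν ^ 2 ^ l)) e 1)
      (by simp [h3.1]) (by simp [h3.1]) (by simpa) (by simpa)).2
    simp only [Expr.cost_mul, Expr.cost_div, Expr.cost_rd, Expr.cost_one, Expr.rangeSize,
      Expr.cost_add, Expr.cost_two, Expr.cost_floor, Expr.eval_div, Expr.eval_mul, Expr.eval_rd,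
      Expr.eval_two]
    omega
  rintro σ₄ ⟨h4, hlog4, hu4⟩
  refine Terminates.seq (Terminates.assign (P := fun τ => HoldsInput M l ν π τ ∧ τ logk = l ∧
    τ u₁ = ν ^ 2 ^ l * (1 / rangeSize (M * π ^ l)) ∧
    τ l₁ = ν ^ 2 ^ l * (1 / rangeSize (M * π ^ l)))
    (by simp) (by simp; omega)
    ⟨h4.congr rfl rfl rfl rfl, by simpa using hlog4, by simpa using hu4, by simpa using hu4⟩) ?_
  rintro σ₅ ⟨h5, hlog5, hu5, hl5⟩
  refine Terminates.seq (Terminates.assign (P := fun τ => HoldsInput M l ν π τ ∧ τ logk = l ∧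
    τ u₁ = ν ^ 2 ^ l * (1 / rangeSize (M * π ^ l)) ∧
    τ l₁ = ν ^ 2 ^ l * (1 / rangeSize (M * π ^ l)) ∧ τ d = 0)
    (by simp) (by simp; omega)
    ⟨h5.congr rfl rfl rfl rfl, by simpa using hlog5, by simpa using hu5, by simpa using hl5,
      by simp⟩) ?_
  rintro σ₆ ⟨h6, hlog6, hu6, hl6, hd6⟩
  refine (Terminates.whileLT l (5000 * Y + (100 + (100 + 100))) 3
    (fun i τ => HoldsInput M l ν π τ ∧ τ logk = l ∧ τ d = i ∧
      τ u₁ = (∏ j ∈ Finset.range i, (firstMomentInductFactors M l π j).1)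
        * (ν ^ 2 ^ l * (1 / rangeSize (M * π ^ l))) ∧
      τ l₁ = (∏ j ∈ Finset.range i, (firstMomentInductFactors M l π j).2)
        * (ν ^ 2 ^ l * (1 / rangeSize (M * π ^ l))))
    ⟨h6, hlog6, by simpa using hd6, by simpa using hu6, by simpa using hl6⟩
    (fun i τ hi hI => ⟨by simp, by simp, by simp, by simp [hI.2.1, hI.2.2.1]⟩)
    ?_).mono le_rfl fun τ h => ⟨h.1, h.2.2.2.1, h.2.2.2.2⟩
  rintro i τ hi ⟨hI, hlog, hd, hu, hl⟩
  refine Terminates.seq (terminates_firstMomentInductFactorsCmd hI.1 hI.2.1 hI.2.2.2 hd hπ hπ1 hi)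
    ?_
  rintro τ₁ ⟨ha, hb, hr⟩
  refine Terminates.seq (Terminates.assign (P := fun τ => τ = _) (by simp) (by simp) rfl) ?_
  rintro _ rfl
  refine Terminates.seq (Terminates.assign (P := fun τ => τ = _) (by simp) (by simp) rfl) ?_
  rintro _ rfl
  refine Terminates.assign (by simp) (by simp) ⟨hI.congr ?_ ?_ ?_ ?_, ?_, ?_, ?_, ?_⟩
  · simp [hr]
  · simp [hr]
  · simp [hr]
  · simp [hr]
  · simp [hr, hlog]
  · simp [hr, hd]
  · simp [hr, ha, hu, Finset.prod_range_succ]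
    ring
  · simp [hr, hb, hl, Finset.prod_range_succ]
    ring

lemma terminates_secondMomentUBCmd {σ : State} {M l : ℕ} {ν π : ℝ} (hν : 0 ≤ ν) (hπ : 0 ≤ π)
    (hπ1 : π ≤ 1) (hin : HoldsInput M l ν π σ) :
    Terminates secondMomentUBCmd σ (7000 * (Nat.size M + l + 1) ^ 2) (fun τ =>
      τ u₁ = σ u₁ ∧ τ l₁ = σ l₁ ∧ τ u₂ = secondMomentUB π l M ν) := by
  set Y := Nat.size M + l + 1 with hY
  have hlY : l * (3 + (6000 * Y + (100 + 100))) ≤ Y * (6500 * Y) :=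
    Nat.mul_le_mul (by omega) (by omega)
  have hYY : Y ≤ Y ^ 2 := Nat.le_self_pow two_ne_zero Y
  have hYY' : Y * (6500 * Y) = 6500 * Y ^ 2 := by ring
  refine Terminates.mono (S := 100 * Y + (100 * Y + (100 * Y + ((l * (3 + (6000 * Y + (100 + 100)))
    + 3) + 100 * Y)))) (P := fun τ =>
      τ u₁ = σ u₁ ∧ τ l₁ = σ l₁ ∧ τ u₂ = secondMomentUB π l M ν) ?_ (by omega) fun _ h => h
  refine Terminates.seq (Terminates.assign (P := fun τ => τ = _) (by simp) (by simp; omega) rfl) ?_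
  rintro _ rfl
  refine Terminates.seq (Terminates.assign (P := fun τ => τ = _) (by simp) (by simp; omega) rfl) ?_
  rintro _ rfl
  refine Terminates.seq (Terminates.assign (P := fun τ => τ = _) (by simp) (by simp; omega) rfl) ?_
  rintro _ rfl
  obtain ⟨hm, hk, hn, hp⟩ := hin
  -- the recursion is a tail recursion: its value on the current arguments does not change
  -- (it is `secondMomentUB` at the registers `m'` and `n'` with `l - i` rounds left)
  refine Terminates.seq (Terminates.whileLT l (6000 * Y + (100 + 100)) 3
    (fun i τ => i ≤ l → τ u₁ = σ u₁ ∧ τ l₁ = σ l₁ ∧ τ p = π ∧ τ k' = 2 ^ (l - i) ∧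
      0 ≤ τ m' ∧ τ m' ≤ M ∧ 0 ≤ τ n' ∧
      secondMomentUB π (l - i) (τ m') (τ n') = secondMomentUB π l M ν)
    (fun _ => by simp [hm, hk, hn, hp, hν])
    (fun i τ hi hI => ⟨by simp, by simp, by simp, by
      simp [(hI hi).2.2.2.1, one_lt_two_pow_iff]⟩)
    ?_) ?_
  · intro i τ hi hI
    obtain ⟨hu, hl, hp', hk', hm0, hmM, hn0, hI⟩ := hI hi.le
    obtain ⟨j, hj⟩ : ∃ j, l - i = j + 1 := ⟨l - i - 1, by omega⟩
    have hj' : l - (i + 1) = j := by omega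
    have hQ := probUnifXMRDist_pos hm0 hπ hπ1
    have hR := probUnifXMRDistPair_pos hm0 hπ hπ1
    have hp0 : 0 ≤ τ p := hp'.symm ▸ hπ
    have hp1 : τ p ≤ 1 := hp'.symm ▸ hπ1
    have dm : (rd m').Defined τ := trivial
    have dp : (rd p).Defined τ := trivial
    refine Terminates.seq (Terminates.assign (P := fun τ => τ = _) ?_ ?_ rfl) ?_
    · have d1 := Expr.defined_probUnifXMRDist dm dp hm0 hp0 hp1
      have d2 := Expr.defined_probUnifXMRDistPair dm dp hm0 hp0 hp1
      refine ⟨by simp [Expr.sq, Expr.cube, d1, d2], ?_⟩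
      simp only [Expr.eval_add, Expr.eval_mul, Expr.eval_sq, Expr.eval_cube, Expr.eval_rd,
        Expr.eval_two, Expr.eval_probUnifXMRDist, Expr.eval_probUnifXMRDistPair, hp']
      positivity
    · have c1 := Expr.cost_probSumInRange_le hm0 hmM hp0 hp1
      have c2 := Expr.cost_mrDistFromUnif_le hm0 hmM hp0 hp1
      have c3 := Expr.cost_probSumWithTwoRVInRange_le hm0 hmM hp0 hp1
      have c4 := Expr.cost_mrDistFromPairUnif_le hm0 hmM hp0 hp1
      simp only [Expr.sq, Expr.cube, Expr.probUnifXMRDist, Expr.probUnifXMRDistPair,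
        Expr.cost_mul, Expr.cost_add, Expr.cost_sqrt, Expr.cost_two, Expr.cost_rd]
      omega
    rintro _ rfl
    refine Terminates.seq (Terminates.assign (P := fun τ => τ = _) (by simp) (by simp) rfl) ?_
    rintro _ rfl
    refine Terminates.assign (by simp) (by simp) fun _ => ?_
    have h4 : (τ n' ^ 2) ^ 2 = τ n' ^ 4 := by ring
    rw [hj, secondMomentUB] at hI
    simp only [ne_eq, reduceCtorEq, not_false_eq_true, Function.update_of_ne, Function.update_self,
      Expr.eval_sqrt, Expr.eval_add, Expr.eval_mul, Expr.eval_sq, Expr.eval_cube, Expr.eval_rd,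
      Expr.eval_two, Expr.eval_probUnifXMRDist, Expr.eval_probUnifXMRDistPair, Expr.eval_div,
      hu, hl, hp', hk', hj, hj', h4, hI]
    refine ⟨trivial, trivial, trivial, by simp [pow_succ], by positivity, ?_, by positivity,
      trivial⟩
    exact (mul_le_of_le_one_right hm0 hπ1).trans hmM
  · intro τ hI
    obtain ⟨hu, hl, hp', hk', hm0, hmM, hn0, hI⟩ := hI le_rfl
    have hD := rangeSize_pos hm0
    have dm : (rd m').Defined τ := trivial
    refine Terminates.assign ?_ ?_ ⟨by simpa using hu, by simpa using hl, ?_⟩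
    · simp [Expr.defined_rangeSize dm, hD.ne']
    · have : Nat.size ⌊|τ m' / 2|⌋₊ ≤ Nat.size M := by
        refine Nat.size_le_size (Nat.floor_le_of_le ?_)
        rw [abs_of_nonneg (by positivity)]
        linarith
      simp only [Expr.cost_mul, Expr.cost_div, Expr.cost_rd, Expr.cost_one, Expr.rangeSize,
        Expr.cost_add, Expr.cost_two, Expr.cost_floor, Expr.eval_div, Expr.eval_rd, Expr.eval_two]
      omega
    · rw [Nat.sub_self, secondMomentUB] at hI
      simpa using hI

/-- The program computes the pair `probBounds` in `O((log m + log k)²)` steps. -/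
lemma terminates_probBoundsCmd {M l n₀ : ℕ} {π : ℝ} (hn₀ : 1 ≤ n₀) (hπ : 0 ≤ π) (hπ1 : π ≤ 1) :
    Terminates probBoundsCmd (inputState M ((2 ^ l : ℕ) : ℝ) n₀ π)
      (15000 * (Nat.size M + l + 1) ^ 2) (fun τ =>
        τ ub = (probBounds M l n₀ π).1 ∧ τ lb = (probBounds M l n₀ π).2) := by
  set Y := Nat.size M + l + 1 with hY
  have hYY : 1 ≤ Y ^ 2 := Nat.one_le_pow _ _ (by omega)
  refine Terminates.mono (S := 7000 * Y ^ 2 + (7000 * Y ^ 2 + (100 + 100))) (P := fun τ =>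
    τ ub = (probBounds M l n₀ π).1 ∧ τ lb = (probBounds M l n₀ π).2) ?_ (by omega) fun _ h => h
  refine Terminates.seq (terminates_firstMomentBoundsCmd (ν := n₀) hπ hπ1
    ⟨rfl, by simp [inputState], rfl, rfl⟩) ?_
  rintro σ₁ ⟨h1, hu1, hl1⟩
  refine Terminates.seq (terminates_secondMomentUBCmd (by positivity) hπ hπ1 h1) ?_
  rintro σ₂ ⟨hu2, hl2, hU⟩
  have hpos : 0 < secondMomentUB π l M n₀ :=
    secondMomentUB_pos hπ hπ1 l (by positivity) (by exact_mod_cast hn₀)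
  refine Terminates.seq (Terminates.assign (P := fun τ => τ = _) (by simp) (by simp) rfl) ?_
  rintro _ rfl
  refine Terminates.assign (by simp [Expr.sq, hU, hpos.ne']) (by simp [Expr.sq]) ⟨?_, ?_⟩
  · simp [probBounds, hu2, hu1]
  · simp [probBounds, hl2, hl1, hU]

lemma size_le_log {M : ℕ} (hM : 1 ≤ Real.log M) : (Nat.size M : ℝ) ≤ 3 * Real.log M := by
  have hM0 : M ≠ 0 := by
    rintro rfl
    norm_num at hM
  obtain ⟨z, hz⟩ : ∃ z, Nat.size M = z + 1 :=
    Nat.exists_eq_succ_of_ne_zero fun h => hM0 (Nat.size_eq_zero.1 h)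
  have h1 : 2 ^ z ≤ M := Nat.lt_size.1 (by omega)
  have h2 : (z : ℝ) * Real.log 2 ≤ Real.log M := by
    rw [← Real.log_pow]
    exact Real.log_le_log (by positivity) (by exact_mod_cast h1)
  have h3 := Real.log_two_gt_d9
  have h4 : (0 : ℝ) ≤ z := by positivity
  rw [hz]
  push_cast
  nlinarith

end KTree

theorem theorem3p1 :
    -- `C` and `e` are absolute constants
    ∃ (C : ℝ) (e : ℕ), ∀ l m n : ℕ, 2 ≤ l → 1 ≤ n → 30 ^ (l + 1) < m →
      ∀ p : ℝ, p = (m : ℝ) ^ (-(1 : ℝ) / ((l : ℝ) + 1)) →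
      -- `UB` and `LB` bound the success probability
      (KTree.probBounds m l n p).2 ≤ KTree.successProb l n m p ∧
      KTree.successProb l n m p ≤ (KTree.probBounds m l n p).1 ∧
      -- they come from bounds on the first two moments
      (KTree.firstMomentBounds m l n p).2
          ≤ KTree.expectation (fun L => (KTree.zeroCount l n m p L : ℝ)) ∧
      KTree.expectation (fun L => (KTree.zeroCount l n m p L : ℝ))
          ≤ (KTree.firstMomentBounds m l n p).1 ∧
      KTree.expectation (fun L => (KTree.zeroCount l n m p L : ℝ) ^ 2)
          ≤ KTree.secondMomentUB p l m n ∧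
      -- the program computes `UB` and `LB` in polylogarithmic time
      ∃ (σ : KTree.State) (t : ℕ),
        KTree.Exec KTree.probBoundsCmd (KTree.inputState m ((2 ^ l : ℕ) : ℝ) n p) σ t ∧
        σ KTree.Reg.ub = (KTree.probBounds m l n p).1 ∧
        σ KTree.Reg.lb = (KTree.probBounds m l n p).2 ∧
        (t : ℝ) ≤ C * (Real.log m + Real.log ((2 ^ l : ℕ) : ℝ) + Real.log n) ^ e := by
  refine ⟨15000 * 4 ^ 2, 2, fun l m n _ hn hm p hp => ?_⟩
  have hm1 : (1 : ℝ) ≤ m := by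
    have : 0 < 30 ^ (l + 1) := by positivity
    exact_mod_cast (by omega : 1 ≤ m)
  have hp0 : 0 ≤ p := hp ▸ by positivity
  have hp1 : p ≤ 1 := by
    rw [hp]
    exact Real.rpow_le_one_of_one_le_of_nonpos hm1
      (div_nonpos_of_nonpos_of_nonneg (by norm_num) (by positivity))
  obtain ⟨h1, h2, h3⟩ := KTree.moment_bounds hp0 hp1 l n m
  obtain ⟨σ, t, hσ, ht, hub, hlb⟩ :=
    KTree.terminates_probBoundsCmd (M := m) (l := l) hn hp0 hp1
  refine ⟨KTree.probBounds_snd_le_successProb hp0 hp1 l m hn,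
    KTree.successProb_le_probBounds_fst hp0 hp1 l n m, h1, h2, h3, σ, t, hσ, hub, hlb, ?_⟩
  have hlog30 : 1 ≤ Real.log 30 := by
    rw [Real.le_log_iff_exp_le (by norm_num)]
    have := Real.exp_one_lt_d9
    linarith
  have hlog : (l : ℝ) + 1 ≤ Real.log m := by
    have h30 : ((l + 1 : ℕ) : ℝ) * Real.log 30 ≤ Real.log m := by
      rw [← Real.log_pow]
      exact Real.log_le_log (by positivity) (by exact_mod_cast hm.le)
    push_cast at h30
    nlinarith [show (0 : ℝ) ≤ l by positivity]
  have hsize := KTree.size_le_log (M := m) (by linarith [show (0 : ℝ) ≤ l by positivity])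
  have hk : 0 ≤ Real.log ((2 ^ l : ℕ) : ℝ) := Real.log_natCast_nonneg _
  have hn' : 0 ≤ Real.log n := Real.log_natCast_nonneg _
  have hY : (Nat.size m + l + 1 : ℝ)
      ≤ 4 * (Real.log m + Real.log ((2 ^ l : ℕ) : ℝ) + Real.log n) := by linarith
  calc (t : ℝ) ≤ 15000 * (Nat.size m + l + 1 : ℝ) ^ 2 := by exact_mod_cast ht
    _ ≤ 15000 * (4 * (Real.log m + Real.log ((2 ^ l : ℕ) : ℝ) + Real.log n)) ^ 2 := by gcongr
    _ = _ := by ring
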